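/- Let $q$ be an indeterminate. Write $(a;q)_k=\prod_{j=0}^{k-1}(1-aq^j)$ and $(a_1,a_2;q)_k=(a_1;q)_k(a_2;q)_k$ for $k\ge 0$, $[m]_q=(1-q^m)/(1-q)$ for integers $m$, and let $\Phi_n(q)$ be the $n$-th cyclotomic polynomial. For rational functions $A(q),B(q)\in\mathbb{Q}(q)$ and a polynomial $P(q)$, write $A\equiv B\pmod{P}$ if $P$ divides the numerator of the reduced form of $A-B$. Theorem. Let $n$ be a positive odd integer, $d$ a positive integer with $\gcd(n,d)=1$, and $r$ an integer with $n-dn+d\le r\le n$ and $n\equiv r\pmod d$. Then, modulo $\Phi_n(-q)^3\Phi_n(q)^2$, $$\sum_{k=0}^{(n-r)/d}(-1)^k\frac{(1+q^{2dk+r})(q^{2r};q^{2d})_k^2}{(1+q^r)(q^{2d};q^{2d})_k^2}\,q^{dk^2+k(d-r)} \equiv(-1)^{(n-r)/d}\frac{[n]_{q^2}}{[r]_{q^2}}\,q^{(n-r)(n+r-d)/d}\sum_{k=0}^{(n-r)/d}\frac{(q^{2r},q^r;q^{2d})_k}{(q^{2d},q^{2d+r};q^{2d})_k}\,q^{2k(d-r)}.$$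 -/

import Mathlib

open Polynomial

/-- The `q`-shifted factorial `(a; q)_k = ∏_{j=0}^{k-1} (1 - a q^j)` in a commutative ring. -/
def qShifted {K : Type*} [CommRing K] (a q : K) (k : ℕ) : K :=
  ∏ j ∈ Finset.range k, (1 - a * q ^ j)

/-- The `q`-integer `[m]_q = (1 - q^m) / (1 - q)`, for an arbitrary integer `m`. -/
def qInteger {K : Type*} [Field K] (q : K) (m : ℤ) : K :=
  (1 - q ^ m) / (1 - q)

/-- Congruence of two rational functions of `q` modulo a polynomial `P`: the polynomial `P` divides
the numerator of `A - B` written in lowest terms. -/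
def RatFuncModEq (P : ℚ[X]) (A B : RatFunc ℚ) : Prop :=
  P ∣ (A - B).num

/-! Put `x = q^r`, `Q = q^(2d)`, `M = (n-r)/d` and `u = q^(2n)`, so that `u = x² Q^M`. A limiting
case of Watson's transformation (`watson_transformation`) with last numerator parameters `x² u` and
`Q⁻ᴹ = x²/u` is an exact identity. Its parameters occur in pairs `a u, a/u`, so apart from a
prefactor `1 - u` it depends on `u` only through `w = u + u⁻¹ - 2 = (1-u)²/u` (`watson_symmetric`).
The two sides of the theorem are this identity with `w` replaced by `0`.

At a root of `Φ_n(q)` or `Φ_n(-q)`, `u = 1`, so `w` vanishes to second order. The error is `w` times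
a function regular there; on the right, the factor `1 - u` cancels the only possible pole, that of
`1/(1 - x Q^k)` at `2k = M`. This gives the squares of both cyclotomic factors
(`exists_left_sub_right_eq`).

At a root of `Φ_n(-q)` the cofactor also vanishes. The right-hand error keeps its factor `1 - u`. On
the left, the coefficient of `w` is a sum over `k` of an antisymmetric term (`leftCoeff_reflect`)
times a symmetric logarithmic derivative (`sum_reflect`) under `k ↦ M - k`, hence zero. The sign
behind the antisymmetry is `(q^n)^(M+1) = (-1)^(M+1)`, which is where `q^n = -1` enters. -/

/-! ### Elementary rules for `q`-shifted factorials. -/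

section ShiftedFactorial
variable {K : Type*} [CommRing K] (a q : K)

theorem qShifted_zero : qShifted a q 0 = 1 := by simp [qShifted]

theorem qShifted_succ (k : ℕ) : qShifted a q (k + 1) = qShifted a q k * (1 - a * q ^ k) := by
  simp [qShifted, Finset.prod_range_succ]

theorem qShifted_succ' (k : ℕ) : qShifted a q (k + 1) = (1 - a) * qShifted (a * q) q k := by
  simp only [qShifted, Finset.prod_range_succ', pow_zero, mul_one]
  rw [mul_comm]
  congr 1
  exact Finset.prod_congr rfl fun j _ => by ring

theorem qShifted_add (j i : ℕ) :
    qShifted a q (j + i) = qShifted a q j * qShifted (a * q ^ j) q i := by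
  simp only [qShifted, Finset.prod_range_add]
  congr 1
  exact Finset.prod_congr rfl fun l _ => by ring

theorem qShifted_ne_zero [IsDomain K] {k : ℕ} (h : ∀ i < k, a * q ^ i ≠ 1) :
    qShifted a q k ≠ 0 :=
  Finset.prod_ne_zero_iff.2 fun i hi => sub_ne_zero.2 (h i (Finset.mem_range.1 hi)).symm

end ShiftedFactorial

/-! ### Two terminating summations: a limiting `₆φ₅` and a balanced `₃φ₂`. -/

section Summation
variable {K : Type*} [Field K]

theorem qShifted_inv_pow_succ_self {Q : K} (hQ : Q ≠ 0) (N : ℕ) :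
    qShifted (Q⁻¹ ^ N) Q (N + 1) = 0 := by
  rw [qShifted_succ, ← mul_pow, inv_mul_cancel₀ hQ]; simp

/-- The `i`-th term, times `1 - a`, of the terminating very-well-poised series
`₆φ₅(a, D, ∞, Q⁻ᴺ)`. -/
def wellPoisedTerm (a D Q : K) (N i : ℕ) : K :=
  (1 - a * Q ^ (2 * i)) *
    ((qShifted a Q i * qShifted D Q i * qShifted (Q⁻¹ ^ N) Q i) /
      (qShifted Q Q i * qShifted (a * Q / D) Q i * qShifted (a * Q ^ (N + 1)) Q i)) *
    ((-1) ^ i * Q ^ (i.choose 2) * (a * Q ^ (N + 1) / D) ^ i)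

/-- Telescoping certificate for the recurrence in `N` that the closed form of the `₆φ₅` sum
satisfies. The partial sums carry the factor `(Q⁻ᴺ; Q)_m`, so they vanish at `m = N + 1`. The bound
on `m` keeps the denominators `1 - (aQ/D) Qⁱ` within the range `i ≤ N`. -/
theorem sum_wellPoisedTerm_sub {a D Q : K} (hQ : Q ≠ 0) (hD : D ≠ 0)
    (hQ1 : ∀ i, Q ^ (i + 1) ≠ 1) (ha : ∀ i, a * Q ^ i ≠ 1) (N : ℕ)
    (hb : ∀ i ≤ N, a * Q / D * Q ^ i ≠ 1) (m : ℕ) (hm : m ≤ N + 1) :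
    ∑ i ∈ Finset.range (m + 1),
        ((1 - a * Q / D * Q ^ N) * wellPoisedTerm a D Q (N + 1) i -
          (1 - a * Q * Q ^ N) * wellPoisedTerm a D Q N i) =
      -(1 - a * Q * Q ^ N) *
        ((qShifted a Q m * qShifted D Q m * qShifted (Q⁻¹ ^ N) Q m) /
          (qShifted Q Q m * qShifted (a * Q / D) Q m * qShifted (a * Q ^ (N + 1)) Q m)) *
        ((-1) ^ m * Q ^ (m.choose 2) * (a * Q ^ (N + 1) / D) ^ m) *
        (Q * Q ^ N * (1 - a * Q ^ m) * (1 - D * Q ^ m) * Q ^ m * (a / D) /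
          (1 - a * Q * Q ^ N * Q ^ m)) := by
  have hN : 1 - a * Q * Q ^ N ≠ 0 := by
    rw [mul_assoc, ← pow_succ']; exact sub_ne_zero.2 (ha _).symm
  induction m with
  | zero =>
    simp only [wellPoisedTerm, qShifted_zero, zero_add, Finset.sum_range_one]
    simp only [Nat.choose_zero_succ, pow_zero, mul_zero, mul_one, div_one]
    field_simp
    ring
  | succ m ih =>
    rw [Finset.sum_range_succ, ih (by omega)]
    have h1 : 1 - Q * Q ^ m ≠ 0 := by rw [← pow_succ']; exact sub_ne_zero.2 (hQ1 _).symm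
    have h2 : 1 - a * Q / D * Q ^ m ≠ 0 := sub_ne_zero.2 (hb _ (by omega)).symm
    have h2' : D - a * Q * Q ^ m ≠ 0 := by
      intro h; apply h2; field_simp; linear_combination h
    have h3 : 1 - a * Q * Q ^ N * Q ^ m ≠ 0 := by
      rw [show a * Q * Q ^ N * Q ^ m = a * Q ^ (N + m + 1) by ring]
      exact sub_ne_zero.2 (ha _).symm
    have h4 : 1 - a * Q * Q ^ N * Q ^ m * Q ≠ 0 := by
      rw [show a * Q * Q ^ N * Q ^ m * Q = a * Q ^ (N + m + 2) by ring]
      exact sub_ne_zero.2 (ha _).symm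
    have e1 : qShifted (Q⁻¹ ^ (N + 1)) Q (m + 1) =
        (1 - (Q * Q ^ N)⁻¹) * qShifted (Q⁻¹ ^ N) Q m := by
      rw [qShifted_succ']
      congr 2
      · rw [inv_pow, pow_succ']
      · rw [pow_succ, mul_assoc, inv_mul_cancel₀ hQ, mul_one]
    have e2 : qShifted (a * Q ^ (N + 2)) Q (m + 1) =
        qShifted (a * Q ^ (N + 1)) Q m * (1 - a * Q * Q ^ N * Q ^ m) *
          (1 - a * Q * Q ^ N * Q ^ m * Q) / (1 - a * Q * Q ^ N) := by
      rw [eq_div_iff hN]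
      have := qShifted_succ' (a * Q ^ (N + 1)) Q (m + 1)
      rw [qShifted_succ, qShifted_succ] at this
      rw [show a * Q ^ (N + 2) = a * Q ^ (N + 1) * Q by ring]
      linear_combination -this
    have e3 : qShifted (Q⁻¹ ^ N) Q (m + 1) =
        qShifted (Q⁻¹ ^ N) Q m * (1 - (Q ^ N)⁻¹ * Q ^ m) := by
      rw [qShifted_succ, inv_pow]
    have hY : Q ^ N ≠ 0 := pow_ne_zero _ hQ
    have q1 : qShifted Q Q m ≠ 0 := qShifted_ne_zero _ _ fun i _ => by
      rw [← pow_succ']; exact hQ1 i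
    have q2 : qShifted (a * Q / D) Q m ≠ 0 := qShifted_ne_zero _ _ fun i _ => hb i (by omega)
    have q3 : qShifted (a * Q ^ (N + 1)) Q m ≠ 0 := qShifted_ne_zero _ _ fun i _ => by
      rw [mul_assoc, ← pow_add]; exact ha _
    unfold wellPoisedTerm
    rw [show N + 1 + 1 = N + 2 from rfl, e1, e2, e3]
    simp only [qShifted_succ]
    rw [show (m + 1).choose 2 = m.choose 2 + m by
      rw [Nat.choose_succ_succ' m 1, Nat.choose_one_right, add_comm]]
    rw [show a * Q ^ (N + 2) / D = (a * Q ^ (N + 1) / D) * Q by ring, mul_pow _ Q,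
      pow_succ (a * Q ^ (N + 1) / D) m]
    have e4 : a * Q ^ (N + 1) * Q ^ m = a * Q * Q ^ N * Q ^ m := by ring
    rw [e4]
    generalize qShifted (Q⁻¹ ^ N) Q m = A1
    generalize qShifted a Q m = A2
    generalize qShifted D Q m = A3
    generalize qShifted Q Q m = A4 at *
    generalize qShifted (a * Q / D) Q m = A5 at *
    generalize qShifted (a * Q ^ (N + 1)) Q m = A6 at *
    generalize (a * Q ^ (N + 1) / D) ^ m = A7 at *
    simp only [pow_add, pow_mul', pow_one, mul_add, mul_one]
    generalize Q ^ m = J at *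
    generalize Q ^ N = Y at *
    generalize Q ^ (m.choose 2) = A8 at *
    generalize (-1 : K) ^ m = A9 at *
    clear ih e1 e2 e3 hb ha hQ1 hm
    -- What remains of the telescoping step once the factors common to all three terms are removed,
    -- with `J = Q^m` and `Y = Q^N`.
    have core : -(1 - Q * J) * (1 - a * Q / D * J) * (1 - a * Q * Y * J * Q) -
        (1 - a * Q / D * Y) * (1 - a * (J ^ 2 * Q ^ 2)) * (1 - (Q * Y)⁻¹) * Q * J +
        (1 - a * (J ^ 2 * Q ^ 2)) * (1 - Y⁻¹ * J) * (1 - a * Q * Y * J * Q) =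
        (1 - Y⁻¹ * J) * Q * Y * (1 - a * (J * Q)) * (1 - D * (J * Q)) * J * Q * (a / D) := by
      field_simp
      ring
    rw [show a * Q * Y * (J * Q) = a * Q * Y * J * Q by ring,
      show a * (Y * Q) / D = a / D * Y * Q by ring]
    generalize 1 - Q * J = B1 at *
    generalize 1 - a * Q / D * J = B2 at *
    generalize 1 - a * Q * Y * J * Q = B4 at *
    generalize 1 - a * Q * Y * J = B3 at *
    generalize 1 - a * Q * Y = B5 at *
    generalize 1 - a * Q / D * Y = X6 at *
    generalize 1 - a * (J ^ 2 * Q ^ 2) = X3 at *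
    generalize 1 - (Q * Y)⁻¹ = X7 at *
    generalize 1 - Y⁻¹ * J = X8 at *
    generalize 1 - a * (J * Q) = X4 at *
    generalize 1 - D * (J * Q) = X5 at *
    generalize 1 - D * J = X2 at *
    generalize 1 - a * J = X1 at *
    generalize a / D = c at *
    rw [← sub_eq_zero]
    trans A1 * A2 * A3 / (A4 * A5 * A6) * A7 * A8 * A9 * (X1 * X2 * J * (c * Y * Q) * B5 / B3) /
      (B1 * B2 * B4) * ((-B1 * B2 * B4 - X6 * X3 * X7 * Q * J + X3 * X8 * B4) -
        X8 * Q * Y * X4 * X5 * J * Q * c)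
    · field_simp
      ring
    · rw [core, sub_self, mul_zero]

theorem sum_wellPoisedTerm {a D Q : K} (hQ : Q ≠ 0) (hD : D ≠ 0)
    (hQ1 : ∀ i, Q ^ (i + 1) ≠ 1) (ha : ∀ i, a * Q ^ i ≠ 1) (N : ℕ)
    (hb : ∀ i < N, a * Q / D * Q ^ i ≠ 1) :
    ∑ i ∈ Finset.range (N + 1), wellPoisedTerm a D Q N i =
      qShifted a Q (N + 1) / qShifted (a * Q / D) Q N := by
  induction N with
  | zero => simp [wellPoisedTerm, qShifted_zero, qShifted_succ]
  | succ N ih =>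
    have key := sum_wellPoisedTerm_sub hQ hD hQ1 ha N (fun i hi => hb i (by omega)) (N + 1) le_rfl
    rw [qShifted_inv_pow_succ_self hQ, Finset.sum_sub_distrib, ← Finset.mul_sum,
      ← Finset.mul_sum] at key
    have hlast : wellPoisedTerm a D Q N (N + 1) = 0 := by
      rw [wellPoisedTerm, qShifted_inv_pow_succ_self hQ]; simp
    rw [Finset.sum_range_succ (wellPoisedTerm a D Q N), hlast, add_zero,
      ih fun i hi => hb i (by omega)] at key
    have h2 : 1 - a * Q / D * Q ^ N ≠ 0 := sub_ne_zero.2 (hb _ (by omega)).symm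
    have q2 : qShifted (a * Q / D) Q N ≠ 0 := qShifted_ne_zero _ _ fun i _ => hb i (by omega)
    rw [qShifted_succ a, qShifted_succ (a * Q / D), eq_div_iff (mul_ne_zero q2 h2)]
    have : (1 - a * Q / D * Q ^ N) *
        ∑ i ∈ Finset.range (N + 1 + 1), wellPoisedTerm a D Q (N + 1) i =
        (1 - a * Q * Q ^ N) * (qShifted a Q (N + 1) / qShifted (a * Q / D) Q N) := by
      linear_combination key
    rw [mul_comm (qShifted (a * Q / D) Q N), ← mul_assoc, mul_comm _ (1 - a * Q / D * Q ^ N),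
      this]
    field_simp
    ring

/-- The `j`-th term of the balanced series `₃φ₂(Q⁻ᵏ, x²Qᵏ, x; x², xQ; Q)`, divided by `1 - x`. -/
def balancedTerm (x Q : K) (k j : ℕ) : K :=
  (qShifted (Q⁻¹ ^ k) Q j * qShifted (x ^ 2 * Q ^ k) Q j * Q ^ j) /
    (qShifted Q Q j * qShifted (x ^ 2) Q j * (1 - x * Q ^ j))

/-- The same telescoping method, now with a recurrence in `k`; the factor `(Q⁻ᵏ; Q)_m` makes the
right side vanish at `m = k + 1`. -/
theorem sum_balancedTerm_sub {x Q : K} (hQ : Q ≠ 0) (hQ1 : ∀ i, Q ^ (i + 1) ≠ 1)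
    (ha : ∀ i, x ^ 2 * Q ^ i ≠ 1) (hx : ∀ i, x * Q ^ i ≠ 1) (k m : ℕ) :
    ∑ j ∈ Finset.range (m + 1),
        ((1 - x ^ 2 * Q ^ k) * (1 - x * Q * Q ^ k) * balancedTerm x Q (k + 1) j -
          x * (1 - Q * Q ^ k) * (1 - x * Q ^ k) * balancedTerm x Q k j) =
      (qShifted (Q⁻¹ ^ k) Q m * qShifted (x ^ 2 * Q ^ k) Q m) /
          (qShifted Q Q m * qShifted (x ^ 2) Q m) *
        (1 - x ^ 2 * Q ^ k * Q ^ m) * (1 - x ^ 2 * Q * (Q ^ k) ^ 2) / (1 - x ^ 2 * Q ^ k) := by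
  have hk : 1 - x ^ 2 * Q ^ k ≠ 0 := sub_ne_zero.2 (ha _).symm
  induction m with
  | zero =>
    have := hx 0
    rw [pow_zero, mul_one] at this
    have hx0 : 1 - x ≠ 0 := sub_ne_zero.2 this.symm
    simp only [balancedTerm, qShifted_zero, zero_add, Finset.sum_range_one, pow_zero, mul_one,
      div_one]
    field_simp
    ring
  | succ m ih =>
    rw [Finset.sum_range_succ, ih]
    have h1 : 1 - Q * Q ^ m ≠ 0 := by rw [← pow_succ']; exact sub_ne_zero.2 (hQ1 _).symm
    have h2 : 1 - x ^ 2 * Q ^ m ≠ 0 := sub_ne_zero.2 (ha _).symm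
    have h3 : 1 - x * Q ^ m * Q ≠ 0 := by
      rw [mul_assoc, ← pow_succ]; exact sub_ne_zero.2 (hx _).symm
    have e1 : qShifted (Q⁻¹ ^ (k + 1)) Q (m + 1) =
        (1 - (Q * Q ^ k)⁻¹) * qShifted (Q⁻¹ ^ k) Q m := by
      rw [qShifted_succ']
      congr 2
      · rw [inv_pow, pow_succ']
      · rw [pow_succ, mul_assoc, inv_mul_cancel₀ hQ, mul_one]
    have e2 : qShifted (x ^ 2 * Q ^ (k + 1)) Q (m + 1) =
        qShifted (x ^ 2 * Q ^ k) Q m * (1 - x ^ 2 * Q ^ k * Q ^ m) *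
          (1 - x ^ 2 * Q ^ k * Q ^ m * Q) / (1 - x ^ 2 * Q ^ k) := by
      rw [eq_div_iff hk]
      have := qShifted_succ' (x ^ 2 * Q ^ k) Q (m + 1)
      rw [qShifted_succ, qShifted_succ] at this
      rw [show x ^ 2 * Q ^ (k + 1) = x ^ 2 * Q ^ k * Q by ring]
      linear_combination -this
    have e3 : qShifted (Q⁻¹ ^ k) Q (m + 1) =
        qShifted (Q⁻¹ ^ k) Q m * (1 - (Q ^ k)⁻¹ * Q ^ m) := by
      rw [qShifted_succ, inv_pow]
    have hY : Q ^ k ≠ 0 := pow_ne_zero _ hQ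
    have q1 : qShifted Q Q m ≠ 0 := qShifted_ne_zero _ _ fun i _ => by
      rw [← pow_succ']; exact hQ1 i
    have q2 : qShifted (x ^ 2) Q m ≠ 0 := qShifted_ne_zero _ _ fun i _ => ha i
    unfold balancedTerm
    rw [e1, e2, e3]
    simp only [qShifted_succ]
    generalize qShifted (Q⁻¹ ^ k) Q m = A1
    generalize qShifted (x ^ 2 * Q ^ k) Q m = A2
    generalize qShifted Q Q m = A4 at *
    generalize qShifted (x ^ 2) Q m = A5 at *
    simp only [pow_succ Q m]
    generalize Q ^ m = J at *
    generalize Q ^ k = Y at *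
    rw [← mul_assoc x J Q]
    have h1' : 1 - J * Q ≠ 0 := by rwa [mul_comm]
    field_simp
    ring

theorem sum_balancedTerm {x Q : K} (hQ : Q ≠ 0) (hQ1 : ∀ i, Q ^ (i + 1) ≠ 1)
    (ha : ∀ i, x ^ 2 * Q ^ i ≠ 1) (hx : ∀ i, x * Q ^ i ≠ 1) (k : ℕ) :
    ∑ j ∈ Finset.range (k + 1), balancedTerm x Q k j =
      x ^ k * qShifted Q Q k / (qShifted (x ^ 2) Q k * (1 - x * Q ^ k)) := by
  induction k with
  | zero => simp [balancedTerm, qShifted_zero]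
  | succ k ih =>
    have key := sum_balancedTerm_sub hQ hQ1 ha hx k (k + 1)
    rw [qShifted_inv_pow_succ_self hQ, Finset.sum_sub_distrib, ← Finset.mul_sum,
      ← Finset.mul_sum] at key
    have hlast : balancedTerm x Q k (k + 1) = 0 := by
      rw [balancedTerm, qShifted_inv_pow_succ_self hQ]; simp
    rw [Finset.sum_range_succ (balancedTerm x Q k), hlast, add_zero, ih] at key
    have h1 : 1 - x ^ 2 * Q ^ k ≠ 0 := sub_ne_zero.2 (ha _).symm
    have h2 : 1 - x * Q ^ k ≠ 0 := sub_ne_zero.2 (hx _).symm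
    have h3 : 1 - x * Q ^ (k + 1) ≠ 0 := sub_ne_zero.2 (hx _).symm
    have q2 : qShifted (x ^ 2) Q k ≠ 0 := qShifted_ne_zero _ _ fun i _ => ha i
    have h4 : 1 - x * Q * Q ^ k ≠ 0 := by rwa [mul_assoc, ← pow_succ']
    rw [qShifted_succ (x ^ 2), qShifted_succ Q, show x * Q ^ (k + 1) = x * Q * Q ^ k by ring,
      eq_div_iff (by positivity)]
    have : (1 - x ^ 2 * Q ^ k) * (1 - x * Q * Q ^ k) *
        ∑ i ∈ Finset.range (k + 1 + 1), balancedTerm x Q (k + 1) i =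
        x * (1 - Q * Q ^ k) * (1 - x * Q ^ k) *
          (x ^ k * qShifted Q Q k / (qShifted (x ^ 2) Q k * (1 - x * Q ^ k))) := by
      linear_combination key
    rw [show ∀ S : K, S * (qShifted (x ^ 2) Q k * (1 - x ^ 2 * Q ^ k) * (1 - x * Q * Q ^ k)) =
      qShifted (x ^ 2) Q k * ((1 - x ^ 2 * Q ^ k) * (1 - x * Q * Q ^ k) * S) by intro S; ring,
      this]
    field_simp
    ring

end Summation

/-! ### Watson's transformation from the two summations. -/

section Watson
variable {K : Type*} [Field K]

/-- Reversing the product turns `(Q^(-(j+i)); Q)_j` into `(Q;Q)_{j+i} / (Q;Q)_i` up to a sign and a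
power of `Q`. -/
theorem qShifted_inv_pow_mul {Q : K} (hQ : Q ≠ 0) (j i : ℕ) :
    qShifted (Q⁻¹ ^ (j + i)) Q j * Q ^ ((j + 1).choose 2) * Q ^ (i * j) * qShifted Q Q i =
      (-1) ^ j * qShifted Q Q (j + i) := by
  induction j with
  | zero => simp [qShifted_zero]
  | succ j ih =>
    have h : Q⁻¹ ^ (j + 1 + i) * Q ^ (j + 1 + i) = 1 := by
      rw [← mul_pow, inv_mul_cancel₀ hQ, one_pow]
    have h' : Q⁻¹ ^ (j + 1 + i) * Q = Q⁻¹ ^ (j + i) := by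
      rw [show j + 1 + i = j + i + 1 by ring, pow_succ, mul_assoc, inv_mul_cancel₀ hQ, mul_one]
    rw [qShifted_succ', h', show (j + 1 + 1).choose 2 = (j + 1).choose 2 + (j + 1) by
      rw [Nat.choose_succ_succ' (j + 1) 1, Nat.choose_one_right, add_comm],
      show j + 1 + i = j + i + 1 by ring, qShifted_succ]
    rw [show j + 1 + i = j + i + 1 by ring] at h
    calc _ = (Q ^ (j + i + 1) - Q⁻¹ ^ (j + i + 1) * Q ^ (j + i + 1)) *
          (qShifted (Q⁻¹ ^ (j + i)) Q j * Q ^ ((j + 1).choose 2) * Q ^ (i * j) * qShifted Q Q i) := by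
          ring
      _ = _ := by rw [ih, h]; ring

/-- The coefficient with which the `₆φ₅` series of parameter `x² Q^(2j)` enters the transformation
of a well-poised series with last numerator parameters `D` and `Q⁻ᴹ`. -/
def watsonCoeff (x D Q : K) (M j : ℕ) : K :=
  (qShifted (x ^ 2) Q (2 * j) * (qShifted D Q j * qShifted (Q⁻¹ ^ M) Q j) * (Q / x ^ 2) ^ j) /
    ((1 + x) * (qShifted Q Q j * qShifted (x ^ 2) Q j * (1 - x * Q ^ j)) *
      (qShifted (x ^ 2 * Q ^ (M + 1)) Q j * qShifted (x ^ 2 * Q / D) Q j))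

/-- In the double sum with outer index `k = j + i`, the dependence on `i` at fixed `j` is a summable
`₆φ₅` term with base parameter `x² Q^(2j)`. -/
theorem wellPoised_mul_balancedTerm {x D Q : K} {M : ℕ} (hQ : Q ≠ 0) (hx : x ≠ 0)
    (hQ1 : ∀ i, Q ^ (i + 1) ≠ 1) (hD : D = x ^ 4 * Q ^ M) (j i : ℕ) (hj : j ≤ M) :
    (-1) ^ (j + i) * (1 - x ^ 2 * Q ^ (2 * (j + i))) / (1 + x) * Q ^ ((j + i + 1).choose 2) *
        (x ^ 2)⁻¹ ^ (j + i) * (qShifted (x ^ 2) Q (j + i) / qShifted Q Q (j + i)) *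
        balancedTerm x Q (j + i) j *
        ((qShifted D Q (j + i) * qShifted (Q⁻¹ ^ M) Q (j + i)) /
          (qShifted (x ^ 2 * Q ^ (M + 1)) Q (j + i) * qShifted (x ^ 2 * Q / D) Q (j + i))) =
      watsonCoeff x D Q M j * wellPoisedTerm (x ^ 2 * Q ^ (2 * j)) (D * Q ^ j) Q (M - j) i := by
  have hD0 : D ≠ 0 := by rw [hD]; positivity
  have hQk : ∀ k, qShifted Q Q k ≠ 0 := fun k => qShifted_ne_zero _ _ fun i _ => by
    rw [← pow_succ']; exact hQ1 i
  obtain ⟨N, rfl⟩ := Nat.exists_eq_add_of_le hj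
  have hN : j + N - j = N := by omega
  rw [hN]
  have e1 : qShifted (x ^ 2) Q (j + i) * qShifted (x ^ 2 * Q ^ (j + i)) Q j =
      qShifted (x ^ 2) Q (2 * j) * qShifted (x ^ 2 * Q ^ (2 * j)) Q i := by
    rw [← qShifted_add, ← qShifted_add]; congr 1; ring
  have e2 := qShifted_inv_pow_mul hQ j i
  have e3 : x ^ 2 * Q ^ (2 * j) * Q / (D * Q ^ j) = x ^ 2 * Q / D * Q ^ j := by
    rw [show Q ^ (2 * j) = Q ^ j * Q ^ j by ring]; field_simp
  -- The choice `D = x⁴ Qᴹ` is what makes the argument of the `₆φ₅` series independent of `j`.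
  have e4 : x ^ 2 * Q ^ (2 * j) * Q ^ (N + 1) / (D * Q ^ j) = Q / x ^ 2 := by
    rw [hD, show Q ^ (2 * j) = Q ^ j * Q ^ j by ring, pow_add, pow_add]; field_simp
  have e5 : Q⁻¹ ^ (j + N) * Q ^ j = Q⁻¹ ^ N := by
    rw [pow_add, mul_right_comm, ← mul_pow, inv_mul_cancel₀ hQ, one_pow, one_mul]
  have e6 : x ^ 2 * Q ^ (2 * j) * Q ^ (N + 1) = x ^ 2 * Q ^ (j + N + 1) * Q ^ j := by ring
  have e7 : (j + i + 1).choose 2 = (j + 1).choose 2 + i.choose 2 + (i * j + i) := by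
    have h1 := Nat.triangle_succ (j + i)
    have h2 := Nat.triangle_succ j
    have h3 := Nat.triangle_succ i
    have c : ∀ m : ℕ, (m : ℚ) * (m - 1) / 2 = (m.choose 2 : ℚ) := fun m =>
      (Nat.cast_choose_two ℚ m).symm
    have : (((j + i + 1).choose 2 : ℕ) : ℚ) =
        (((j + 1).choose 2 + i.choose 2 + (i * j + i) : ℕ) : ℚ) := by
      push_cast [← c]; ring
    exact_mod_cast this
  unfold watsonCoeff wellPoisedTerm balancedTerm
  rw [e3, e4, e6, qShifted_add D, qShifted_add (Q⁻¹ ^ (j + N)), e5,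
    qShifted_add (x ^ 2 * Q ^ (j + N + 1)), qShifted_add (x ^ 2 * Q / D), e7]
  have e8 : qShifted (Q⁻¹ ^ (j + i)) Q j =
      (-1) ^ j * qShifted Q Q (j + i) / (Q ^ ((j + 1).choose 2) * Q ^ (i * j) * qShifted Q Q i) := by
    rw [eq_div_iff (mul_ne_zero (by positivity) (hQk i)), ← e2]; ring
  have e9 : (-1 : K) ^ (j + i) * (-1) ^ j = (-1) ^ i := by
    rw [pow_add, mul_right_comm, ← mul_pow]; simp
  rw [e8, show x ^ 2 * Q ^ (2 * (j + i)) = x ^ 2 * Q ^ (2 * j) * Q ^ (2 * i) by ring]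
  have q1 := hQk i
  have q2 := hQk (j + i)
  calc _ = ((-1 : K) ^ (j + i) * (-1) ^ j) *
        (qShifted (x ^ 2) Q (j + i) * qShifted (x ^ 2 * Q ^ (j + i)) Q j) *
        ((qShifted Q Q (j + i))⁻¹ * qShifted Q Q (j + i)) *
        ((Q ^ (j + 1).choose 2)⁻¹ * Q ^ (j + 1).choose 2) *
        ((Q ^ (i * j))⁻¹ * Q ^ (i * j)) *
        ((1 - x ^ 2 * Q ^ (2 * j) * Q ^ (2 * i)) / (1 + x) * (Q / x ^ 2) ^ j * (Q / x ^ 2) ^ i *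
        Q ^ (i.choose 2) / (qShifted Q Q i * (qShifted Q Q j * qShifted (x ^ 2) Q j *
          (1 - x * Q ^ j))) *
        (qShifted D Q j * qShifted (D * Q ^ j) Q i *
          (qShifted (Q⁻¹ ^ (j + N)) Q j * qShifted (Q⁻¹ ^ N) Q i) /
          (qShifted (x ^ 2 * Q ^ (j + N + 1)) Q j * qShifted (x ^ 2 * Q ^ (j + N + 1) * Q ^ j) Q i *
          (qShifted (x ^ 2 * Q / D) Q j * qShifted (x ^ 2 * Q / D * Q ^ j) Q i)))) := by
          simp only [div_eq_mul_inv, mul_pow, pow_add, mul_inv]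
          ring
    _ = _ := by
      rw [e9, e1, inv_mul_cancel₀ q2, inv_mul_cancel₀ (by positivity),
        inv_mul_cancel₀ (by positivity)]
      simp only [div_eq_mul_inv, mul_inv]
      ring

theorem sum_range_sum_range_succ {A : Type*} [AddCommMonoid A] (M : ℕ) (f : ℕ → ℕ → A) :
    ∑ k ∈ Finset.range (M + 1), ∑ j ∈ Finset.range (k + 1), f k j =
      ∑ j ∈ Finset.range (M + 1), ∑ i ∈ Finset.range (M - j + 1), f (j + i) j := by
  rw [Finset.sum_comm' (t' := Finset.range (M + 1)) (s' := fun j => Finset.Ico j (M + 1))]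
  · refine Finset.sum_congr rfl fun j hj => ?_
    rw [Finset.sum_Ico_eq_sum_range]
    congr 2
    have := Finset.mem_range.1 hj
    omega
  · intro k j
    simp only [Finset.mem_range, Finset.mem_Ico]
    omega

theorem div_mul_pow_ne_one {x D Q : K} {M : ℕ} (hQ : Q ≠ 0) (hx : x ≠ 0)
    (ha : ∀ i, x ^ 2 * Q ^ i ≠ 1) (hD : D = x ^ 4 * Q ^ M) {i : ℕ} (hi : i < M) :
    x ^ 2 * Q / D * Q ^ i ≠ 1 := by
  intro h
  obtain ⟨t, rfl⟩ := Nat.exists_eq_add_of_lt hi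
  apply ha t
  rw [hD, pow_add, pow_add] at h
  field_simp at h
  exact h.symm

/-- A limiting case of Watson's transformation of a terminating very-well-poised `₈φ₇` series. -/
theorem watson_transformation {x D Q : K} {M : ℕ} (hQ : Q ≠ 0) (hx : x ≠ 0)
    (hQ1 : ∀ i, Q ^ (i + 1) ≠ 1) (ha : ∀ i, x ^ 2 * Q ^ i ≠ 1) (hD : D = x ^ 4 * Q ^ M) :
    ∑ k ∈ Finset.range (M + 1),
        (-1) ^ k * ((1 + x * Q ^ k) / (1 + x)) * Q ^ ((k + 1).choose 2) * x⁻¹ ^ k *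
        ((qShifted D Q k * qShifted (Q⁻¹ ^ M) Q k) /
          (qShifted (x ^ 2 * Q ^ (M + 1)) Q k * qShifted (x ^ 2 * Q / D) Q k)) =
      qShifted (x ^ 2) Q (M + 1) / ((1 + x) * qShifted (x ^ 2 * Q / D) Q M) *
        ∑ j ∈ Finset.range (M + 1),
          (qShifted D Q j * qShifted (Q⁻¹ ^ M) Q j * (Q / x ^ 2) ^ j) /
            (qShifted Q Q j * qShifted (x ^ 2) Q j * (1 - x * Q ^ j)) := by
  have hx1 : ∀ i, x * Q ^ i ≠ 1 := fun i h => ha (2 * i) (by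
    rw [show x ^ 2 * Q ^ (2 * i) = (x * Q ^ i) ^ 2 by ring, h, one_pow])
  have hD0 : D ≠ 0 := by rw [hD]; positivity
  -- Each term is expanded by the balanced summation: its value supplies the denominator `1 - x Q^k`
  -- that completes `1 + x Q^k` to the very-well-poised factor `1 - x² Q^(2k)`. Interchanging the
  -- sums then leaves inner `₆φ₅` series.
  have step : ∀ k, (-1) ^ k * ((1 + x * Q ^ k) / (1 + x)) * Q ^ ((k + 1).choose 2) * x⁻¹ ^ k *
        ((qShifted D Q k * qShifted (Q⁻¹ ^ M) Q k) /
          (qShifted (x ^ 2 * Q ^ (M + 1)) Q k * qShifted (x ^ 2 * Q / D) Q k)) =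
      ∑ j ∈ Finset.range (k + 1), (-1) ^ k * (1 - x ^ 2 * Q ^ (2 * k)) / (1 + x) *
        Q ^ ((k + 1).choose 2) *
        (x ^ 2)⁻¹ ^ k * (qShifted (x ^ 2) Q k / qShifted Q Q k) *
        balancedTerm x Q k j *
        ((qShifted D Q k * qShifted (Q⁻¹ ^ M) Q k) /
          (qShifted (x ^ 2 * Q ^ (M + 1)) Q k * qShifted (x ^ 2 * Q / D) Q k)) := by
    intro k
    have h1 : 1 - x * Q ^ k ≠ 0 := sub_ne_zero.2 (hx1 k).symm
    have q1 : qShifted Q Q k ≠ 0 := qShifted_ne_zero _ _ fun i _ => by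
      rw [← pow_succ']; exact hQ1 i
    have q2 : qShifted (x ^ 2) Q k ≠ 0 := qShifted_ne_zero _ _ fun i _ => ha i
    rw [← Finset.sum_mul, ← Finset.mul_sum, sum_balancedTerm hQ hQ1 ha hx1]
    congr 1
    rw [show 1 - x ^ 2 * Q ^ (2 * k) = (1 + x * Q ^ k) * (1 - x * Q ^ k) by ring,
      show (x ^ 2)⁻¹ ^ k = x⁻¹ ^ k * x⁻¹ ^ k by rw [← mul_pow, ← inv_pow]; congr 1; ring]
    have hxk : x⁻¹ ^ k * x ^ k = 1 := by rw [← mul_pow, inv_mul_cancel₀ hx, one_pow]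
    generalize x⁻¹ ^ k = y at *
    generalize x ^ k = z at *
    generalize qShifted Q Q k = A at *
    generalize qShifted (x ^ 2) Q k = B at *
    generalize 1 - x * Q ^ k = C at *
    calc _ = (-1) ^ k * ((1 + x * Q ^ k) / (1 + x)) * Q ^ (k + 1).choose 2 * y * (y * z) *
          (A / A) * (B / B) * (C / C) := by
          rw [hxk, div_self q1, div_self q2, div_self h1]; ring
      _ = _ := by ring
  rw [Finset.sum_congr rfl fun k _ => step k, sum_range_sum_range_succ, Finset.mul_sum]
  refine Finset.sum_congr rfl fun j hj => ?_
  have hjM : j ≤ M := by have := Finset.mem_range.1 hj; omega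
  rw [Finset.sum_congr rfl fun i _ => wellPoised_mul_balancedTerm hQ hx hQ1 hD j i hjM,
    ← Finset.mul_sum]
  have e3 : x ^ 2 * Q ^ (2 * j) * Q / (D * Q ^ j) = x ^ 2 * Q / D * Q ^ j := by
    rw [show Q ^ (2 * j) = Q ^ j * Q ^ j by ring]; field_simp
  rw [sum_wellPoisedTerm hQ (by positivity) hQ1
    (fun i => by rw [mul_assoc, ← pow_add]; exact ha _) _ (fun i hi => by
      rw [e3, mul_assoc, ← pow_add]
      exact div_mul_pow_ne_one hQ hx ha hD (by omega)), e3]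
  have e4 : qShifted (x ^ 2) Q (2 * j) * qShifted (x ^ 2 * Q ^ (2 * j)) Q (M - j + 1) =
      qShifted (x ^ 2) Q (M + 1) * qShifted (x ^ 2 * Q ^ (M + 1)) Q j := by
    rw [← qShifted_add, ← qShifted_add]; congr 1; omega
  have e5 : qShifted (x ^ 2 * Q / D) Q j * qShifted (x ^ 2 * Q / D * Q ^ j) Q (M - j) =
      qShifted (x ^ 2 * Q / D) Q M := by
    rw [← qShifted_add]; congr 1; omega
  have q3 : qShifted (x ^ 2 * Q ^ (M + 1)) Q j ≠ 0 := qShifted_ne_zero _ _ fun i _ => by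
    rw [mul_assoc, ← pow_add]; exact ha _
  unfold watsonCoeff
  rw [← e5]
  calc _ = (qShifted (x ^ 2) Q (2 * j) * qShifted (x ^ 2 * Q ^ (2 * j)) Q (M - j + 1)) *
        (qShifted (x ^ 2 * Q ^ (M + 1)) Q j)⁻¹ *
        (qShifted D Q j * qShifted (Q⁻¹ ^ M) Q j * (Q / x ^ 2) ^ j) /
        ((1 + x) * (qShifted Q Q j * qShifted (x ^ 2) Q j * (1 - x * Q ^ j)) *
        (qShifted (x ^ 2 * Q / D) Q j * qShifted (x ^ 2 * Q / D * Q ^ j) Q (M - j))) := by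
        simp only [div_eq_mul_inv, mul_inv]; ring
    _ = _ := by
        rw [e4, mul_assoc (qShifted (x ^ 2) Q (M + 1)), mul_inv_cancel₀ q3]
        simp only [div_eq_mul_inv, mul_inv]; ring

end Watson

/-! ### The form symmetric in `u` and `u⁻¹`, and reflection `k ↦ M - k`. -/

section Symmetric
variable {K : Type*} [Field K]

/-- `∏_{j<k} ((1 - a Qʲ)² - a Qʲ w)`, which is `(a u, a / u; Q)_k` for `w = u + u⁻¹ - 2`. -/
def symmShifted (a Q w : K) (k : ℕ) : K :=
  ∏ j ∈ Finset.range k, ((1 - a * Q ^ j) ^ 2 - a * Q ^ j * w)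

theorem symmShifted_eq {a Q u : K} (hu : u ≠ 0) (k : ℕ) :
    symmShifted a Q (u + u⁻¹ - 2) k = qShifted (a * u) Q k * qShifted (a / u) Q k := by
  simp only [symmShifted, qShifted, ← Finset.prod_mul_distrib]
  refine Finset.prod_congr rfl fun j _ => ?_
  field_simp
  ring

theorem symmShifted_zero (a Q : K) (k : ℕ) : symmShifted a Q 0 k = qShifted a Q k ^ 2 := by
  simp [symmShifted, qShifted, Finset.prod_pow]

theorem qShifted_reverse {a Q : K} (ha : a ≠ 0) (hQ : Q ≠ 0) (M : ℕ) :
    qShifted a Q M = (-1) ^ M * a ^ M * Q ^ (M.choose 2) * qShifted (Q / (a * Q ^ M)) Q M := by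
  induction M with
  | zero => simp [qShifted_zero]
  | succ M ih =>
    rw [qShifted_succ, ih, qShifted_succ',
      show Q / (a * Q ^ (M + 1)) * Q = Q / (a * Q ^ M) by rw [pow_succ]; field_simp,
      show (M + 1).choose 2 = M.choose 2 + M by
        rw [Nat.choose_succ_succ' M 1, Nat.choose_one_right, add_comm],
      show Q / (a * Q ^ (M + 1)) = 1 / (a * Q ^ M) by rw [pow_succ]; field_simp]
    have : (1 - 1 / (a * Q ^ M)) * (a * Q ^ M) = a * Q ^ M - 1 := by field_simp
    rw [pow_add]
    linear_combination (-1) ^ (M + 1) * a ^ M * Q ^ (M.choose 2) *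
      qShifted (Q / (a * Q ^ M)) Q M * (-this)

/-- The coefficient of the left-hand series. -/
def leftCoeff (x Q : K) (k : ℕ) : K :=
  (-1) ^ k * ((1 + x * Q ^ k) / (1 + x)) * Q ^ ((k + 1).choose 2) * x⁻¹ ^ k

/-- The coefficient of the right-hand series. -/
def rightCoeff (x Q : K) (k : ℕ) : K :=
  (Q / x ^ 2) ^ k / (qShifted Q Q k * qShifted (x ^ 2) Q k * (1 - x * Q ^ k))

/-- The factor in front of the right-hand series, divided by `1 - x² Qᴹ`. -/
def prefactor (x Q : K) (M : ℕ) : K :=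
  (-1) ^ M * (x ^ 2) ^ M * Q ^ (M.choose 2) / (1 + x)

/-- With `D = x² u` one has `Q⁻ᴹ = x²/u`, and the denominators become `Q u` and `Q/u`, so the
factorials pair up. In the prefactor, `(x²;Q)_{M+1} = (1 - u)(x²;Q)_M`, and reversing `(x²;Q)_M`
cancels `(Q/u;Q)_M`. -/
theorem watson_symmetric {x Q u : K} {M : ℕ} (hQ : Q ≠ 0) (hx : x ≠ 0)
    (hQ1 : ∀ i, Q ^ (i + 1) ≠ 1) (ha : ∀ i, x ^ 2 * Q ^ i ≠ 1) (hu : u = x ^ 2 * Q ^ M) :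
    ∑ k ∈ Finset.range (M + 1), leftCoeff x Q k *
        (symmShifted (x ^ 2) Q (u + u⁻¹ - 2) k / symmShifted Q Q (u + u⁻¹ - 2) k) =
      (1 - u) * prefactor x Q M *
        ∑ k ∈ Finset.range (M + 1), rightCoeff x Q k * symmShifted (x ^ 2) Q (u + u⁻¹ - 2) k := by
  have hu0 : u ≠ 0 := by rw [hu]; positivity
  have hD : x ^ 2 * u = x ^ 4 * Q ^ M := by rw [hu]; ring
  have h1 : x ^ 2 / u = Q⁻¹ ^ M := by rw [hu, inv_pow]; field_simp
  have h2 : Q * u = x ^ 2 * Q ^ (M + 1) := by rw [hu]; ring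
  have h3 : x ^ 2 * Q / (x ^ 2 * u) = Q / u := by field_simp
  have key := watson_transformation hQ hx hQ1 ha hD
  rw [h3] at key
  have q1 : qShifted (Q / u) Q M ≠ 0 := qShifted_ne_zero _ _ fun i hi => by
    rw [← h3]; exact div_mul_pow_ne_one hQ hx ha hD hi
  simp only [symmShifted_eq hu0, h1, h2, leftCoeff, rightCoeff]
  rw [key]
  congr 1
  · rw [qShifted_succ, qShifted_reverse (by positivity) hQ, ← hu, prefactor]
    field_simp
  · refine Finset.sum_congr rfl fun j _ => ?_
    ring

theorem one_sub_sq_div {u : K} (hu : u ≠ 0) : u + u⁻¹ - 2 = (1 - u) ^ 2 / u := by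
  field_simp
  ring

/-- At `a = Q⁻ᴹ` the terms of the left-hand series are antisymmetric under `k ↦ M - k`. -/
theorem leftCoeff_reflect {x Q : K} (hQ : Q ≠ 0) (hx : x ≠ 0) (k i : ℕ)
    (hQ1 : ∀ l < k + i, Q ^ (l + 1) ≠ 1) (hM : x ^ 2 * Q ^ (k + i) = 1)
    (hs : Q ^ ((k + i + 1).choose 2) * x ^ (k + i + 1) = (-1) ^ (k + i + 1)) :
    leftCoeff x Q i * (qShifted (x ^ 2) Q i / qShifted Q Q i) ^ 2 =
      -(leftCoeff x Q k * (qShifted (x ^ 2) Q k / qShifted Q Q k) ^ 2) := by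
  have ha : x ^ 2 = Q⁻¹ ^ (k + i) := by
    rw [inv_pow]; exact eq_inv_of_mul_eq_one_left hM
  have hq : ∀ l ≤ k + i, qShifted Q Q l ≠ 0 := fun l hl => qShifted_ne_zero _ _ fun s hs => by
    rw [← pow_succ']; exact hQ1 s (by omega)
  have e1 := qShifted_inv_pow_mul hQ k i
  have e2 := qShifted_inv_pow_mul hQ i k
  rw [add_comm i k] at e2
  rw [← ha] at e1 e2
  have q1 := hq k (by omega)
  have q2 := hq i (by omega)
  have r1 : qShifted (x ^ 2) Q k / qShifted Q Q k = (-1) ^ k * (qShifted Q Q (k + i) /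
      (qShifted Q Q k * qShifted Q Q i)) / (Q ^ ((k + 1).choose 2) * Q ^ (i * k)) := by
    rw [eq_div_iff (by positivity), div_mul_eq_mul_div, div_eq_iff q1]
    field_simp
    linear_combination e1
  have r2 : qShifted (x ^ 2) Q i / qShifted Q Q i = (-1) ^ i * (qShifted Q Q (k + i) /
      (qShifted Q Q k * qShifted Q Q i)) / (Q ^ ((i + 1).choose 2) * Q ^ (i * k)) := by
    rw [eq_div_iff (by positivity), div_mul_eq_mul_div, div_eq_iff q2]
    field_simp
    rw [mul_comm k i] at e2
    linear_combination e2
  rw [r1, r2]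
  generalize qShifted Q Q (k + i) / (qShifted Q Q k * qShifted Q Q i) = B
  have hchoose : ∀ m : ℕ, 2 * (m + 1).choose 2 = m * (m + 1) := fun m => by
    have := Nat.triangle_succ m
    have h := Nat.choose_two_right (m + 1)
    have h2 : 2 ∣ (m + 1) * (m + 1 - 1) := by
      simpa [mul_comm] using (Nat.even_mul_succ_self m).two_dvd
    rw [h, Nat.mul_div_cancel' h2]; simp [mul_comm]
  have hc : (k + i + 1).choose 2 = (k + 1).choose 2 + (i + 1).choose 2 + i * k := by
    have h1 := hchoose (k + i); have h2 := hchoose k; have h3 := hchoose i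
    nlinarith
  have hM' : x ^ (2 * k) * Q ^ (k * k + i * k) = 1 := by
    rw [show x ^ (2 * k) * Q ^ (k * k + i * k) = (x ^ 2 * Q ^ (k + i)) ^ k by ring, hM, one_pow]
  have hk : Q ^ ((k + 1).choose 2) * Q ^ ((k + 1).choose 2) = Q ^ (k * k) * Q ^ k := by
    rw [← pow_add, ← pow_add, ← two_mul, hchoose]; ring
  -- The sign hypothesis `hs`, split along `M = k + i`, compares the powers in the terms `i` and
  -- `k`.
  have hs' : x ^ (i + 1) * Q ^ ((i + 1).choose 2) * Q ^ k =
      (-1) ^ (k + i + 1) * (x ^ k * Q ^ ((k + 1).choose 2)) := by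
    rw [← hs, hc]
    have : x ^ (i + 1) * Q ^ ((i + 1).choose 2) * Q ^ k * (x ^ (2 * k) * Q ^ (k * k + i * k)) =
      x ^ (i + 1) * Q ^ ((i + 1).choose 2) * Q ^ (i * k) * x ^ (2 * k) *
        (Q ^ ((k + 1).choose 2) * Q ^ ((k + 1).choose 2)) := by rw [hk]; ring
    rw [hM', mul_one] at this
    rw [this]; ring
  have hki : (1 + x * Q ^ i) * (x * Q ^ k) = 1 + x * Q ^ k := by
    have h : x ^ 2 * (Q ^ k * Q ^ i) = 1 := by rw [← pow_add, hM]
    linear_combination h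
  unfold leftCoeff
  have hsgn : ((-1 : K) ^ k) * (-1) ^ k = 1 := by rw [← mul_pow]; simp
  have hsgn' : ((-1 : K) ^ i) * (-1) ^ i = 1 := by rw [← mul_pow]; simp
  have t1 : ((-1 : K) ^ i * B / (Q ^ ((i + 1).choose 2) * Q ^ (i * k))) ^ 2 =
    B ^ 2 / (Q ^ ((i + 1).choose 2) * Q ^ (i * k)) ^ 2 := by
      rw [div_pow, mul_pow, sq ((-1 : K) ^ i), hsgn', one_mul]
  have t2 : ((-1 : K) ^ k * B / (Q ^ ((k + 1).choose 2) * Q ^ (i * k))) ^ 2 =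
    B ^ 2 / (Q ^ ((k + 1).choose 2) * Q ^ (i * k)) ^ 2 := by
      rw [div_pow, mul_pow, sq ((-1 : K) ^ k), hsgn, one_mul]
  rw [t1, t2, ← hki]
  have hQk : Q ^ k ≠ 0 := by positivity
  have hxi : x ^ i ≠ 0 := by positivity
  have hxk : x ^ k ≠ 0 := by positivity
  have hc1 : Q ^ ((k + 1).choose 2) ≠ 0 := by positivity
  have hc2 : Q ^ ((i + 1).choose 2) ≠ 0 := by positivity
  rw [pow_succ x i, pow_succ (-1 : K), pow_add (-1 : K)] at hs'
  rw [inv_pow, inv_pow]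
  generalize Q ^ ((k + 1).choose 2) = C1 at *
  generalize Q ^ ((i + 1).choose 2) = C2 at *
  have hQik : Q ^ (i * k) ≠ 0 := by positivity
  generalize Q ^ (i * k) = C3 at *
  generalize 1 + x * Q ^ i = W
  generalize Q ^ k = J at *
  generalize x ^ i = X1 at *
  generalize x ^ k = X2 at *
  generalize (-1 : K) ^ k = S1 at *
  generalize (-1 : K) ^ i = S2 at *
  rw [div_eq_mul_inv W, div_eq_mul_inv (W * _)]
  generalize (1 + x)⁻¹ = V
  have : S2 * X1⁻¹ / C2 = -(S1 * (x * J) * X2⁻¹ / C1) := by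
    field_simp
    linear_combination S1 * hs' - S2 * X2 * C1 * hsgn
  calc _ = (S2 * X1⁻¹ / C2) * (W * V * B ^ 2 / C3 ^ 2) := by field_simp
    _ = _ := by rw [this]; field_simp

/-- At `a = Q⁻ᴹ` the logarithmic derivative in `w`, at `w = 0`, of
`symmShifted a Q w k / symmShifted Q Q w k` is symmetric under `k ↦ M - k`. -/
theorem sum_reflect {Q a : K} (hQ : Q ≠ 0) (k i : ℕ) (hM : a * Q ^ (k + i) = 1) :
    ∑ j ∈ Finset.range k, (Q * Q ^ j / (1 - Q * Q ^ j) ^ 2 - a * Q ^ j / (1 - a * Q ^ j) ^ 2) =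
      ∑ j ∈ Finset.range i,
        (Q * Q ^ j / (1 - Q * Q ^ j) ^ 2 - a * Q ^ j / (1 - a * Q ^ j) ^ 2) := by
  set g : ℕ → K := fun j => Q * Q ^ j / (1 - Q * Q ^ j) ^ 2 with hg
  -- `t/(1-t)²` is invariant under `t ↦ t⁻¹`, and `a Q^j` is the inverse of `Q · Q^(M-1-j)` for `M =
  -- k + i`.
  have hsub : ∀ j < k + i, a * Q ^ j / (1 - a * Q ^ j) ^ 2 = g (k + i - 1 - j) := by
    intro j hj
    have h1 : a * Q ^ j * (Q * Q ^ (k + i - 1 - j)) = 1 := by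
      rw [← pow_succ', mul_assoc, ← pow_add, ← hM]; congr 2; omega
    have h2 : Q * Q ^ (k + i - 1 - j) ≠ 0 := by positivity
    simp only [hg]
    rw [eq_inv_of_mul_eq_one_left h1]
    generalize Q * Q ^ (k + i - 1 - j) = t at *
    by_cases ht : t = 1
    · simp [ht]
    · have h3 : 1 - t ≠ 0 := sub_ne_zero.2 (Ne.symm ht)
      have h4 : t - 1 ≠ 0 := sub_ne_zero.2 ht
      rw [show 1 - t⁻¹ = (t - 1) / t by field_simp]
      field_simp
      ring
  -- With `S_k` the partial sums of `g`, both sides of the goal become `S_k + S_i - S_{k+i}`.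
  have key : ∀ k i : ℕ, ∑ j ∈ Finset.range k, g (k + i - 1 - j) =
      ∑ j ∈ Finset.range (k + i), g j - ∑ j ∈ Finset.range i, g j := by
    intro k i
    rw [add_comm k i, Finset.sum_range_add, add_sub_cancel_left,
      ← Finset.sum_range_reflect (fun j => g (i + j))]
    refine Finset.sum_congr rfl fun j hj => ?_
    have := Finset.mem_range.1 hj
    congr 1; omega
  rw [Finset.sum_sub_distrib, Finset.sum_sub_distrib,
    Finset.sum_congr rfl fun j hj => hsub j (by have := Finset.mem_range.1 hj; omega), key k i,
    Finset.sum_congr (s₁ := Finset.range i) rfl fun j hj =>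
      hsub j (by have := Finset.mem_range.1 hj; omega)]
  rw [add_comm k i, key i k]
  ring

/-- Antisymmetric times symmetric: reflection sends the sum to its negative. The sum is the
coefficient of `w` in the left-hand series. -/
theorem sum_leftCoeff_mul_eq_zero [CharZero K] {x Q : K} {M : ℕ} (hQ : Q ≠ 0) (hx : x ≠ 0)
    (hQ1 : ∀ l < M, Q ^ (l + 1) ≠ 1) (hM : x ^ 2 * Q ^ M = 1)
    (hs : Q ^ ((M + 1).choose 2) * x ^ (M + 1) = (-1) ^ (M + 1)) :
    ∑ k ∈ Finset.range (M + 1), leftCoeff x Q k * ((qShifted (x ^ 2) Q k / qShifted Q Q k) ^ 2 *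
      ∑ j ∈ Finset.range k, (Q * Q ^ j / (1 - Q * Q ^ j) ^ 2 -
        x ^ 2 * Q ^ j / (1 - x ^ 2 * Q ^ j) ^ 2)) = 0 := by
  set f : ℕ → K := fun k => leftCoeff x Q k * ((qShifted (x ^ 2) Q k / qShifted Q Q k) ^ 2 *
      ∑ j ∈ Finset.range k, (Q * Q ^ j / (1 - Q * Q ^ j) ^ 2 -
        x ^ 2 * Q ^ j / (1 - x ^ 2 * Q ^ j) ^ 2)) with hf
  have hrefl : ∀ k ∈ Finset.range (M + 1), f (M + 1 - 1 - k) = -f k := by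
    intro k hk
    obtain ⟨i, rfl⟩ := Nat.exists_eq_add_of_le (Nat.lt_succ_iff.1 (Finset.mem_range.1 hk))
    rw [show k + i + 1 - 1 - k = i by omega]
    simp only [hf]
    rw [← mul_assoc, leftCoeff_reflect hQ hx k i hQ1 hM hs, sum_reflect hQ k i hM]
    ring
  have h := Finset.sum_range_reflect f (M + 1)
  rw [Finset.sum_congr rfl hrefl, Finset.sum_neg_distrib] at h
  exact self_eq_neg.1 h.symm

end Symmetric

/-! ### Values of rational functions at a point, and orders of vanishing. -/

section Values
variable {F : Type*} [Field F] [Algebra ℚ F]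

/-- The rational function `f` is regular at `ζ`, with value `z`. -/
def HasValueAt (ζ : F) (f : RatFunc ℚ) (z : F) : Prop :=
  ∃ N D : ℚ[X], aeval ζ D ≠ 0 ∧
    f = algebraMap ℚ[X] (RatFunc ℚ) N / algebraMap ℚ[X] (RatFunc ℚ) D ∧ z = aeval ζ N / aeval ζ D

variable {ζ : F} {f g : RatFunc ℚ} {y z : F}

theorem algebraMap_ne_zero_of_aeval {D : ℚ[X]} (h : aeval ζ D ≠ 0) :
    algebraMap ℚ[X] (RatFunc ℚ) D ≠ 0 :=
  RatFunc.algebraMap_ne_zero fun h0 => h (by rw [h0, map_zero])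

theorem hasValueAt_algebraMap (N : ℚ[X]) :
    HasValueAt ζ (algebraMap ℚ[X] (RatFunc ℚ) N) (aeval ζ N) :=
  ⟨N, 1, by simp, by simp, by simp⟩

theorem hasValueAt_one : HasValueAt ζ 1 1 := by
  simpa using hasValueAt_algebraMap (ζ := ζ) 1

theorem hasValueAt_zero : HasValueAt ζ 0 0 := by
  simpa using hasValueAt_algebraMap (ζ := ζ) 0

theorem hasValueAt_X : HasValueAt ζ RatFunc.X ζ := by
  simpa using hasValueAt_algebraMap (ζ := ζ) X

theorem HasValueAt.add (hf : HasValueAt ζ f y) (hg : HasValueAt ζ g z) :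
    HasValueAt ζ (f + g) (y + z) := by
  obtain ⟨N, D, hD, rfl, rfl⟩ := hf
  obtain ⟨N', D', hD', rfl, rfl⟩ := hg
  have h1 := algebraMap_ne_zero_of_aeval hD
  have h2 := algebraMap_ne_zero_of_aeval hD'
  refine ⟨N * D' + D * N', D * D', by simp [hD, hD'], ?_, ?_⟩
  · rw [div_add_div _ _ h1 h2]; simp
  · rw [div_add_div _ _ hD hD']; simp

theorem HasValueAt.mul (hf : HasValueAt ζ f y) (hg : HasValueAt ζ g z) :
    HasValueAt ζ (f * g) (y * z) := by
  obtain ⟨N, D, hD, rfl, rfl⟩ := hf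
  obtain ⟨N', D', hD', rfl, rfl⟩ := hg
  exact ⟨N * N', D * D', by simp [hD, hD'], by simp [div_mul_div_comm],
    by simp [div_mul_div_comm]⟩

theorem HasValueAt.neg (hf : HasValueAt ζ f y) : HasValueAt ζ (-f) (-y) := by
  obtain ⟨N, D, hD, rfl, rfl⟩ := hf
  exact ⟨-N, D, hD, by simp [neg_div], by simp [neg_div]⟩

theorem HasValueAt.sub (hf : HasValueAt ζ f y) (hg : HasValueAt ζ g z) :
    HasValueAt ζ (f - g) (y - z) := by
  simpa [sub_eq_add_neg] using hf.add hg.neg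

theorem HasValueAt.inv (hf : HasValueAt ζ f y) (hy : y ≠ 0) : HasValueAt ζ f⁻¹ y⁻¹ := by
  obtain ⟨N, D, hD, rfl, rfl⟩ := hf
  exact ⟨D, N, fun h => hy (by rw [h, zero_div]), by rw [inv_div], by rw [inv_div]⟩

theorem HasValueAt.div (hf : HasValueAt ζ f y) (hg : HasValueAt ζ g z) (hz : z ≠ 0) :
    HasValueAt ζ (f / g) (y / z) := by
  simpa [div_eq_mul_inv] using hf.mul (hg.inv hz)

theorem HasValueAt.pow (hf : HasValueAt ζ f y) (k : ℕ) : HasValueAt ζ (f ^ k) (y ^ k) := by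
  induction k with
  | zero => simpa using hasValueAt_one
  | succ k ih => simpa [pow_succ] using ih.mul hf

theorem HasValueAt.zpow (hf : HasValueAt ζ f y) (hy : y ≠ 0) (k : ℤ) :
    HasValueAt ζ (f ^ k) (y ^ k) := by
  obtain ⟨m, rfl | rfl⟩ := k.eq_nat_or_neg
  · simpa using hf.pow m
  · simpa using (hf.pow m).inv (pow_ne_zero m hy)

theorem HasValueAt.prod {ι : Type*} {s : Finset ι} {f : ι → RatFunc ℚ} {y : ι → F}
    (h : ∀ i ∈ s, HasValueAt ζ (f i) (y i)) : HasValueAt ζ (∏ i ∈ s, f i) (∏ i ∈ s, y i) := by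
  classical
  induction s using Finset.induction_on with
  | empty => simpa using hasValueAt_one
  | insert i s hi ih =>
    rw [Finset.prod_insert hi, Finset.prod_insert hi]
    exact (h i (Finset.mem_insert_self _ _)).mul
      (ih fun j hj => h j (Finset.mem_insert_of_mem hj))

theorem HasValueAt.sum {ι : Type*} {s : Finset ι} {f : ι → RatFunc ℚ} {y : ι → F}
    (h : ∀ i ∈ s, HasValueAt ζ (f i) (y i)) : HasValueAt ζ (∑ i ∈ s, f i) (∑ i ∈ s, y i) := by
  classical
  induction s using Finset.induction_on with
  | empty => simpa using hasValueAt_zero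
  | insert i s hi ih =>
    rw [Finset.sum_insert hi, Finset.sum_insert hi]
    exact (h i (Finset.mem_insert_self _ _)).add
      (ih fun j hj => h j (Finset.mem_insert_of_mem hj))

theorem HasValueAt.shiftedFactorial (hf : HasValueAt ζ f y) (hg : HasValueAt ζ g z) (k : ℕ) :
    HasValueAt ζ (qShifted f g k) (qShifted y z k) :=
  HasValueAt.prod fun j _ => hasValueAt_one.sub (hf.mul (hg.pow j))

theorem HasValueAt.ne_zero (hf : HasValueAt ζ f y) (hy : y ≠ 0) : f ≠ 0 := by
  obtain ⟨N, D, hD, rfl, rfl⟩ := hf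
  exact div_ne_zero (algebraMap_ne_zero_of_aeval fun h => hy (by rw [h, zero_div]))
    (algebraMap_ne_zero_of_aeval hD)

theorem HasValueAt.exists_eq_mul {π : ℚ[X]} (hπ : ∀ p : ℚ[X], aeval ζ p = 0 → π ∣ p)
    (hf : HasValueAt ζ f 0) :
    ∃ h z, HasValueAt ζ h z ∧ f = algebraMap ℚ[X] (RatFunc ℚ) π * h := by
  obtain ⟨N, D, hD, rfl, h0⟩ := hf
  obtain ⟨N', rfl⟩ := hπ N (by simpa [hD] using h0.symm)
  exact ⟨_, _, ⟨N', D, hD, rfl, rfl⟩, by rw [map_mul, mul_div_assoc]⟩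

/-- A denominator that is nonzero at `ζ` is coprime to `π`, so no factor of `π^m` can cancel. -/
theorem HasValueAt.pow_dvd_num {π : ℚ[X]} (hirr : Irreducible π) (hζ : aeval ζ π = 0) {m : ℕ}
    (hg : HasValueAt ζ g z) (hf : f = algebraMap ℚ[X] (RatFunc ℚ) π ^ m * g) : π ^ m ∣ f.num := by
  obtain ⟨N, D, hD, rfl, -⟩ := hg
  have h1 := algebraMap_ne_zero_of_aeval hD
  have h2 : algebraMap ℚ[X] (RatFunc ℚ) f.denom ≠ 0 :=
    RatFunc.algebraMap_ne_zero f.denom_ne_zero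
  have h3 : f.num * D = π ^ m * N * f.denom := by
    apply RatFunc.algebraMap_injective ℚ
    rw [← RatFunc.num_div_denom f, mul_div_assoc', div_eq_div_iff h2 h1] at hf
    simpa using hf
  have hcop : IsCoprime (π ^ m) D := by
    refine IsCoprime.pow_left ((hirr.coprime_iff_not_dvd).2 fun hd => hD ?_)
    obtain ⟨E, rfl⟩ := hd
    rw [map_mul, hζ, zero_mul]
  exact hcop.dvd_of_dvd_mul_right (h3 ▸ (Dvd.intro _ rfl).mul_right _)

/-- First-order expansion in `w` of a product of linear fractional functions of `w`. -/
theorem HasValueAt.exists_prod_sub {w : RatFunc ℚ} (hw : HasValueAt ζ w 0)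
    {A B α β : ℕ → RatFunc ℚ} {A' B' α' β' : ℕ → F} {k : ℕ}
    (hA : ∀ j, HasValueAt ζ (A j) (A' j)) (hB : ∀ j, HasValueAt ζ (B j) (B' j))
    (hα : ∀ j, HasValueAt ζ (α j) (α' j)) (hβ : ∀ j, HasValueAt ζ (β j) (β' j))
    (hA0 : ∀ j < k, A' j ≠ 0) (hB0 : ∀ j < k, B' j ≠ 0) :
    ∃ L, HasValueAt ζ L ((∏ j ∈ Finset.range k, A' j / B' j) *
        ∑ j ∈ Finset.range k, (β' j / B' j - α' j / A' j)) ∧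
      ∏ j ∈ Finset.range k, (A j - α j * w) / (B j - β j * w) -
        ∏ j ∈ Finset.range k, A j / B j = w * L := by
  induction k with
  | zero => exact ⟨0, by simpa using hasValueAt_zero, by simp⟩
  | succ k ih =>
    obtain ⟨L, hL, hLeq⟩ := ih (fun j hj => hA0 j (by omega)) fun j hj => hB0 j (by omega)
    have a0 := hA0 k (by omega)
    have b0 := hB0 k (by omega)
    have hBw : HasValueAt ζ (B k - β k * w) (B' k) := by
      simpa using (hB k).sub ((hβ k).mul hw)
    have hAw : HasValueAt ζ (A k - α k * w) (A' k) := by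
      simpa using (hA k).sub ((hα k).mul hw)
    have hprod : HasValueAt ζ (∏ j ∈ Finset.range k, A j / B j)
        (∏ j ∈ Finset.range k, A' j / B' j) :=
      HasValueAt.prod fun j hj => (hA j).div (hB j)
        (hB0 j (by have := Finset.mem_range.1 hj; omega))
    -- Product rule for finite differences; the last fraction is the difference of the `k`-th
    -- factors divided by `w`.
    refine ⟨L * ((A k - α k * w) / (B k - β k * w)) + (∏ j ∈ Finset.range k, A j / B j) *
      ((A k * β k - α k * B k) / (B k * (B k - β k * w))), ?_, ?_⟩
    · convert (hL.mul (hAw.div hBw b0)).add (hprod.mul ((((hA k).mul (hβ k)).sub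
        ((hα k).mul (hB k))).div ((hB k).mul hBw) (mul_ne_zero b0 b0))) using 1
      rw [Finset.prod_range_succ, Finset.sum_range_succ]
      field_simp
    · have n1 := hBw.ne_zero b0
      have n2 := (hB k).ne_zero b0
      rw [Finset.prod_range_succ, Finset.prod_range_succ, eq_add_of_sub_eq hLeq]
      generalize ∏ j ∈ Finset.range k, A j / B j = P
      obtain ⟨d, hd⟩ : ∃ d, d = B k - β k * w := ⟨_, rfl⟩
      rw [← hd] at n1 ⊢
      field_simp
      rw [hd]
      ring

end Values

/-! ### The error in replacing `w` by `0`. -/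

section Congruence
variable {F : Type*} [Field F] [Algebra ℚ F] {ζ : F}

theorem HasValueAt.exists_symmShifted_sub {x Q w : RatFunc ℚ} {ξ θ : F} {k : ℕ}
    (hw : HasValueAt ζ w 0) (hx : HasValueAt ζ x ξ) (hQ : HasValueAt ζ Q θ)
    (hξ : ∀ j < k, ξ * θ ^ j ≠ 1) :
    ∃ L l, HasValueAt ζ L l ∧ symmShifted x Q w k - qShifted x Q k ^ 2 = w * L := by
  have hxj : ∀ j, HasValueAt ζ (x * Q ^ j) (ξ * θ ^ j) := fun j => hx.mul (hQ.pow j)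
  obtain ⟨L, hL, h⟩ := HasValueAt.exists_prod_sub (k := k) hw
    (A := fun j => (1 - x * Q ^ j) ^ 2) (α := fun j => x * Q ^ j) (B := fun _ => 1)
    (β := fun _ => 0) (fun j => (hasValueAt_one.sub (hxj j)).pow 2) (fun _ => hasValueAt_one)
    hxj (fun _ => hasValueAt_zero)
    (fun j hj => pow_ne_zero _ (sub_ne_zero.2 (hξ j hj).symm)) fun _ _ => one_ne_zero
  refine ⟨L, _, hL, ?_⟩
  rw [← h, symmShifted, qShifted, ← Finset.prod_pow]
  simp

theorem HasValueAt.exists_symmShifted_div_sub {x Q w : RatFunc ℚ} {ξ θ : F} {k : ℕ}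
    (hw : HasValueAt ζ w 0) (hx : HasValueAt ζ x ξ) (hQ : HasValueAt ζ Q θ)
    (hξ : ∀ j < k, ξ * θ ^ j ≠ 1) (hθ : ∀ j < k, θ ^ (j + 1) ≠ 1) :
    ∃ L, HasValueAt ζ L ((qShifted ξ θ k / qShifted θ θ k) ^ 2 *
        ∑ j ∈ Finset.range k, (θ * θ ^ j / (1 - θ * θ ^ j) ^ 2 -
          ξ * θ ^ j / (1 - ξ * θ ^ j) ^ 2)) ∧
      symmShifted x Q w k / symmShifted Q Q w k - (qShifted x Q k / qShifted Q Q k) ^ 2 =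
        w * L := by
  have hxj : ∀ j, HasValueAt ζ (x * Q ^ j) (ξ * θ ^ j) := fun j => hx.mul (hQ.pow j)
  have hQj : ∀ j, HasValueAt ζ (Q * Q ^ j) (θ * θ ^ j) := fun j => hQ.mul (hQ.pow j)
  obtain ⟨L, hL, h⟩ := HasValueAt.exists_prod_sub (k := k) hw
    (A := fun j => (1 - x * Q ^ j) ^ 2) (α := fun j => x * Q ^ j)
    (B := fun j => (1 - Q * Q ^ j) ^ 2) (β := fun j => Q * Q ^ j)
    (fun j => (hasValueAt_one.sub (hxj j)).pow 2) (fun j => (hasValueAt_one.sub (hQj j)).pow 2)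
    hxj hQj (fun j hj => pow_ne_zero _ (sub_ne_zero.2 (hξ j hj).symm))
    fun j hj => pow_ne_zero _ (sub_ne_zero.2 (by rw [← pow_succ']; exact (hθ j hj).symm))
  refine ⟨L, ?_, ?_⟩
  · convert hL using 2
    rw [qShifted, qShifted, ← Finset.prod_div_distrib, ← Finset.prod_pow]
    exact Finset.prod_congr rfl fun j _ => div_pow _ _ _
  · rw [← h, symmShifted, symmShifted, ← Finset.prod_div_distrib, qShifted, qShifted,
      ← Finset.prod_div_distrib, ← Finset.prod_pow]
    congr 1
    exact Finset.prod_congr rfl fun j _ => div_pow _ _ _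

theorem HasValueAt.leftCoefficient {x Q : RatFunc ℚ} {ξ θ : F} (hx : HasValueAt ζ x ξ)
    (hQ : HasValueAt ζ Q θ) (hξ : ξ ≠ 0) (hξ1 : 1 + ξ ≠ 0) (k : ℕ) :
    HasValueAt ζ (leftCoeff x Q k) (leftCoeff ξ θ k) :=
  (((hasValueAt_one.neg.pow k).mul ((hasValueAt_one.add (hx.mul (hQ.pow k))).div
    (hasValueAt_one.add hx) hξ1)).mul (hQ.pow _)).mul ((hx.inv hξ).pow k)

/-- The difference of the two series is `(1 - u)²` times a rational function regular at `ζ`, whose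
value at `ζ` vanishes under the reflection hypothesis. -/
theorem exists_left_sub_right_eq {x Q u : RatFunc ℚ} {ξ θ : F} {M : ℕ} (hM : 0 < M)
    (hx : HasValueAt ζ x ξ) (hQ : HasValueAt ζ Q θ) (hξ : ξ ≠ 0) (hθ : θ ≠ 0)
    (hQ1 : ∀ i, Q ^ (i + 1) ≠ 1) (ha : ∀ i, x ^ 2 * Q ^ i ≠ 1) (hu : u = x ^ 2 * Q ^ M)
    (hval : ξ ^ 2 * θ ^ M = 1) (hθ1 : ∀ i < M, θ ^ (i + 1) ≠ 1)
    {y : ℕ → F} (hy : ∀ k ≤ M, HasValueAt ζ ((1 - u) / (1 - x * Q ^ k)) (y k)) :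
    ∃ G g, HasValueAt ζ G g ∧
      ∑ k ∈ Finset.range (M + 1), leftCoeff x Q k * (qShifted (x ^ 2) Q k / qShifted Q Q k) ^ 2 -
        (1 - u) * prefactor x Q M *
          ∑ k ∈ Finset.range (M + 1), rightCoeff x Q k * qShifted (x ^ 2) Q k ^ 2 =
        (1 - u) ^ 2 * G ∧
      ((∀ k ≤ M, y k = 0) → θ ^ ((M + 1).choose 2) * ξ ^ (M + 1) = (-1) ^ (M + 1) → g = 0) := by
  have hx0 := hx.ne_zero hξ
  have hQ0 := hQ.ne_zero hθ
  have hu0 : u ≠ 0 := by rw [hu]; positivity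
  have huv : HasValueAt ζ u 1 := by
    rw [hu, ← hval]; exact (hx.pow 2).mul (hQ.pow M)
  have hξθ : ∀ j < M, ξ ^ 2 * θ ^ j ≠ 1 := by
    intro j hj h
    obtain ⟨i, rfl⟩ := Nat.exists_eq_add_of_lt hj
    rw [add_assoc, pow_add, ← mul_assoc, h, one_mul] at hval
    exact hθ1 i (by omega) hval
  have hξ1 : 1 + ξ ≠ 0 := by
    intro h
    have := hξθ 0 hM
    rw [pow_zero, mul_one, eq_neg_of_add_eq_zero_right h] at this
    simp at this
  set w := u + u⁻¹ - 2 with hw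
  have hwv : HasValueAt ζ w 0 := by
    rw [hw, one_sub_sq_div hu0]
    simpa using ((hasValueAt_one.sub huv).pow 2).div huv one_ne_zero
  have hL : ∀ k, ∃ L, k ≤ M → HasValueAt ζ L ((qShifted (ξ ^ 2) θ k / qShifted θ θ k) ^ 2 *
        ∑ j ∈ Finset.range k, (θ * θ ^ j / (1 - θ * θ ^ j) ^ 2 -
          ξ ^ 2 * θ ^ j / (1 - ξ ^ 2 * θ ^ j) ^ 2)) ∧
      symmShifted (x ^ 2) Q w k / symmShifted Q Q w k -
        (qShifted (x ^ 2) Q k / qShifted Q Q k) ^ 2 = w * L := by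
    intro k
    -- Beyond `M` the default `0` serves only to let `choose` produce a function on all of `ℕ`.
    by_cases hk : k ≤ M
    · obtain ⟨L, h⟩ := hwv.exists_symmShifted_div_sub (k := k) (hx.pow 2) hQ
        (fun j hj => hξθ j (by omega)) fun j hj => hθ1 j (by omega)
      exact ⟨L, fun _ => h⟩
    · exact ⟨0, fun h => absurd h hk⟩
  choose L hL using hL
  have hL' : ∀ k, ∃ L l, k ≤ M → HasValueAt ζ L l ∧
      symmShifted (x ^ 2) Q w k - qShifted (x ^ 2) Q k ^ 2 = w * L := by
    intro k
    by_cases hk : k ≤ M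
    · obtain ⟨L, l, h⟩ := hwv.exists_symmShifted_sub (k := k) (hx.pow 2) hQ
        (fun j hj => hξθ j (by omega))
      exact ⟨L, l, fun _ => h⟩
    · exact ⟨0, 0, fun h => absurd h hk⟩
  choose L' l' hL' using hL'
  have hle : ∀ k ∈ Finset.range (M + 1), k ≤ M := fun k hk => by
    have := Finset.mem_range.1 hk; omega
  have hθq : ∀ k ≤ M, qShifted θ θ k ≠ 0 := fun k hk => qShifted_ne_zero _ _ fun i hi => by
    rw [← pow_succ']; exact hθ1 i (by omega)
  have hξq : ∀ k ≤ M, qShifted (ξ ^ 2) θ k ≠ 0 := fun k hk => qShifted_ne_zero _ _ fun i hi =>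
    hξθ i (by omega)
  have vLeft := HasValueAt.sum fun k hk =>
    (hx.leftCoefficient hQ hξ hξ1 k).mul (hL k (hle k hk)).1
  -- The prefactor `1 - u` is moved into each term, since `1/(1 - x Q^k)` alone may have a pole at
  -- `ζ`.
  have vRight := HasValueAt.sum fun k hk => ((hy k (hle k hk)).mul
    (((hQ.div (hx.pow 2) (pow_ne_zero 2 hξ)).pow k).div
      ((hQ.shiftedFactorial hQ k).mul ((hx.pow 2).shiftedFactorial hQ k))
      (mul_ne_zero (hθq k (hle k hk)) (hξq k (hle k hk))))).mul (hL' k (hle k hk)).1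
  have vPre : HasValueAt ζ (prefactor x Q M) (prefactor ξ θ M) :=
    (((hasValueAt_one.neg.pow M).mul ((hx.pow 2).pow M)).mul (hQ.pow _)).div
      (hasValueAt_one.add hx) hξ1
  -- Subtracting the exact identity leaves `w` times (right error minus left error); the division by
  -- `u` comes from `w = (1-u)²/u`.
  refine ⟨_, _, ((vPre.mul vRight).sub vLeft).div huv one_ne_zero, ?_, ?_⟩
  · have key := watson_symmetric (M := M) hQ0 hx0 hQ1 ha hu
    rw [← hw] at key
    have e1 : ∑ k ∈ Finset.range (M + 1), leftCoeff x Q k *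
        (symmShifted (x ^ 2) Q w k / symmShifted Q Q w k) =
        ∑ k ∈ Finset.range (M + 1), leftCoeff x Q k *
          (qShifted (x ^ 2) Q k / qShifted Q Q k) ^ 2 +
        w * ∑ k ∈ Finset.range (M + 1), leftCoeff x Q k * L k := by
      rw [Finset.mul_sum, ← Finset.sum_add_distrib]
      refine Finset.sum_congr rfl fun k hk => ?_
      linear_combination leftCoeff x Q k * (hL k (hle k hk)).2
    have e2 : (1 - u) * prefactor x Q M *
          ∑ k ∈ Finset.range (M + 1), rightCoeff x Q k * symmShifted (x ^ 2) Q w k =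
        (1 - u) * prefactor x Q M *
          ∑ k ∈ Finset.range (M + 1), rightCoeff x Q k * qShifted (x ^ 2) Q k ^ 2 +
        w * (prefactor x Q M * ∑ k ∈ Finset.range (M + 1), (1 - u) / (1 - x * Q ^ k) *
          ((Q / x ^ 2) ^ k / (qShifted Q Q k * qShifted (x ^ 2) Q k)) * L' k) := by
      simp only [Finset.mul_sum]
      rw [← Finset.sum_add_distrib]
      refine Finset.sum_congr rfl fun k hk => ?_
      have h := (hL' k (hle k hk)).2
      rw [rightCoeff]
      simp only [div_eq_mul_inv, mul_inv]
      linear_combination (1 - u) * prefactor x Q M * ((Q * (x ^ 2)⁻¹) ^ k *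
        ((qShifted Q Q k)⁻¹ * (qShifted (x ^ 2) Q k)⁻¹ * (1 - x * Q ^ k)⁻¹)) * h
    rw [e1, e2] at key
    rw [one_sub_sq_div hu0] at hw
    rw [mul_div_assoc', mul_div_right_comm, ← hw]
    linear_combination key
  · intro hy0 hs
    have : CharZero F := algebraRat.charZero F
    rw [sum_leftCoeff_mul_eq_zero hθ hξ hθ1 hval hs, Finset.sum_eq_zero]
    · simp
    · intro k hk
      rw [hy0 k (hle k hk)]
      simp

end Congruence

/-! ### Specialisation to powers of `q` and the cyclotomic factors. -/

section Cyclotomic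

theorem RatFunc.X_zpow_ne_one {m : ℤ} (hm : m ≠ 0) : (RatFunc.X : RatFunc ℚ) ^ m ≠ 1 := by
  have nat : ∀ k : ℕ, k ≠ 0 → (RatFunc.X : RatFunc ℚ) ^ k ≠ 1 := by
    intro k hk h
    rw [← RatFunc.algebraMap_X, ← map_pow, ← map_one (algebraMap ℚ[X] (RatFunc ℚ))] at h
    have := congrArg natDegree (RatFunc.algebraMap_injective ℚ h)
    simp [hk] at this
  obtain ⟨k, rfl | rfl⟩ := m.eq_nat_or_neg
  · rw [zpow_natCast]; exact nat k (by simpa using hm)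
  · rw [zpow_neg, zpow_natCast, Ne, inv_eq_one]
    exact nat k (by simpa using hm)

theorem comp_neg_X_comp_neg_X (p : ℚ[X]) : (p.comp (-X)).comp (-X) = p := by
  rw [comp_assoc]; simp

theorem cyclotomic_dvd_of_aeval {n : ℕ} (hn : 0 < n) {ζ : ℂ} (hζ : IsPrimitiveRoot ζ n)
    (p : ℚ[X]) (hp : aeval ζ p = 0) : cyclotomic n ℚ ∣ p := by
  rw [cyclotomic_eq_minpoly_rat hζ hn]
  exact minpoly.dvd ℚ ζ hp

theorem cyclotomic_comp_neg_dvd_of_aeval {n : ℕ} (hn : 0 < n) {ζ : ℂ} (hζ : IsPrimitiveRoot ζ n)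
    (p : ℚ[X]) (hp : aeval (-ζ) p = 0) : (cyclotomic n ℚ).comp (-X) ∣ p := by
  have h : cyclotomic n ℚ ∣ p.comp (-X) := cyclotomic_dvd_of_aeval hn hζ _ (by
    rw [aeval_comp]; simpa using hp)
  have := map_dvd (compRingHom (-X)) h
  rwa [coe_compRingHom_apply, coe_compRingHom_apply, comp_neg_X_comp_neg_X] at this

theorem aeval_cyclotomic_eq_zero {n : ℕ} (hn : 0 < n) {ζ : ℂ} (hζ : IsPrimitiveRoot ζ n) :
    aeval ζ (cyclotomic n ℚ) = 0 := by
  rw [cyclotomic_eq_minpoly_rat hζ hn]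
  exact minpoly.aeval ℚ ζ

theorem aeval_cyclotomic_comp_neg_eq_zero {n : ℕ} (hn : 0 < n) {ζ : ℂ}
    (hζ : IsPrimitiveRoot ζ n) : aeval (-ζ) ((cyclotomic n ℚ).comp (-X)) = 0 := by
  rw [aeval_comp]
  simpa using aeval_cyclotomic_eq_zero hn hζ

theorem irreducible_cyclotomic_comp_neg {n : ℕ} (hn : 0 < n) :
    Irreducible ((cyclotomic n ℚ).comp (-X)) := by
  have := (MulEquiv.irreducible_iff (algEquivAevalNegX (R := ℚ))).2
    (cyclotomic.irreducible_rat hn)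
  simpa [algEquivAevalNegX, comp, aeval_def] using this

/-- A root `-ζ` of `Φ_n(-q)` satisfies `(-ζ)^n = -1`, as `n` is odd, so it is not an `n`-th root of
unity. -/
theorem isCoprime_cyclotomic_comp_neg {n : ℕ} (hn : Odd n) :
    IsCoprime ((cyclotomic n ℚ).comp (-X)) (cyclotomic n ℚ) := by
  refine ((irreducible_cyclotomic_comp_neg hn.pos).coprime_iff_not_dvd).2 fun h => ?_
  have hζ := Complex.isPrimitiveRoot_exp n hn.pos.ne'
  have h0 : aeval (-Complex.exp (2 * Real.pi * Complex.I / n)) (X ^ n - 1 : ℚ[X]) = 0 := by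
    obtain ⟨p, hp⟩ := h.trans (cyclotomic.dvd_X_pow_sub_one n ℚ)
    rw [hp, map_mul, aeval_cyclotomic_comp_neg_eq_zero hn.pos hζ, zero_mul]
  rw [map_sub, map_pow, aeval_X, map_one, hn.neg_pow, hζ.pow_eq_one] at h0
  norm_num at h0

/-- The two sides of the congruence subtracted, with `x = qʳ`, `Q = q^(2d)` and `u = q^(2n)`. -/
noncomputable def seriesDifference (x Q u : RatFunc ℚ) (M : ℕ) : RatFunc ℚ :=
  ∑ k ∈ Finset.range (M + 1), leftCoeff x Q k * (qShifted (x ^ 2) Q k / qShifted Q Q k) ^ 2 -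
    (1 - u) * prefactor x Q M *
      ∑ k ∈ Finset.range (M + 1), rightCoeff x Q k * qShifted (x ^ 2) Q k ^ 2

variable {n d M : ℕ} {r : ℤ}

/-- Keeps the factors `1 - q^(2(r+di))` nonzero. If `r + di = 0`, then `d ∣ n`, so `d = 1` and `i =
M - n < 0`. -/
theorem add_mul_ne_zero (hd : 0 < d) (hnd : Nat.Coprime n d) (hr : r + d * M = n)
    (hMn : M < n) (i : ℕ) : r + d * i ≠ 0 := by
  intro h
  have h1 : (d : ℤ) ∣ n := ⟨M - i, by linarith⟩
  have h2 : d = 1 := Nat.eq_one_of_dvd_coprimes hnd (Int.natCast_dvd_natCast.1 h1) dvd_rfl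
  subst h2
  push_cast at hr h
  omega

variable {ζ : ℂ}

/-- Requiring only `ζ²` to be primitive treats the roots of `Φ_n(q)` and of `Φ_n(-q)` together; `ζ^n
= -1` singles out the latter. -/
theorem exists_seriesDifference_eq (hn : Odd n) (hd : 0 < d) (hnd : Nat.Coprime n d)
    (hr : r + d * M = n) (hMn : M < n) (hM : 0 < M) (hζ : IsPrimitiveRoot (ζ ^ 2) n) :
    ∃ G g, HasValueAt ζ G g ∧
      seriesDifference (RatFunc.X ^ r) (RatFunc.X ^ (2 * d)) (RatFunc.X ^ (2 * n)) M =
        (1 - RatFunc.X ^ (2 * n)) ^ 2 * G ∧ (ζ ^ n = -1 → g = 0) := by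
  have hζ0 : ζ ≠ 0 := by
    rintro rfl
    have := hζ.pow_eq_one
    rw [zero_pow two_ne_zero, zero_pow hn.pos.ne'] at this
    exact zero_ne_one this
  have hX : (RatFunc.X : RatFunc ℚ) ≠ 0 := RatFunc.X_ne_zero
  have pow2n : ζ ^ (2 * n) = 1 := by rw [pow_mul, hζ.pow_eq_one]
  have hcop : IsCoprime (n : ℤ) (d : ℤ) := Nat.isCoprime_iff_coprime.2 hnd
  -- A pole forces `n ∣ r + 2dk`, hence `n ∣ 2k - M`, where `|2k - M| ≤ M < n`. Then `x Q^k = q^n`,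
  -- and the quotient `(1-u)/(1-q^n)` is `1 + q^n`.
  have hroot : ∀ k ≤ M, ζ ^ r * (ζ ^ (2 * d)) ^ k = 1 → 2 * k = M ∧ ζ ^ n = 1 := by
    intro k hk h
    have h1 : ζ ^ (r + 2 * d * k) = 1 := by
      rw [← h, zpow_add₀ hζ0, ← pow_mul]; norm_cast
    have h2 : (ζ ^ 2) ^ (r + 2 * d * k) = 1 := by
      rw [← zpow_natCast, ← zpow_mul, mul_comm, zpow_mul, h1, one_zpow]
    have h3 := (hζ.zpow_eq_one_iff_dvd _).1 h2
    have h4 : (n : ℤ) ∣ d * (2 * k - M) := by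
      have e : (d : ℤ) * (2 * k - M) = r + 2 * d * k - n := by linear_combination -hr
      exact e ▸ dvd_sub h3 (dvd_refl (n : ℤ))
    have h5 := Int.eq_zero_of_abs_lt_dvd (hcop.dvd_of_dvd_mul_left h4) (by
      rw [abs_lt]; omega)
    refine ⟨by omega, ?_⟩
    rw [← zpow_natCast, ← h1]
    congr 1
    linear_combination -d * h5 - hr
  have hy : ∀ k, ∃ y : ℂ, k ≤ M → HasValueAt ζ
      ((1 - RatFunc.X ^ (2 * n)) / (1 - RatFunc.X ^ r * (RatFunc.X ^ (2 * d)) ^ k)) y ∧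
        (ζ ^ n = -1 → y = 0) := by
    intro k
    by_cases hk : k ≤ M
    swap
    · exact ⟨0, fun h => absurd h hk⟩
    by_cases h1 : ζ ^ r * (ζ ^ (2 * d)) ^ k = 1
    · obtain ⟨h2, h3⟩ := hroot k hk h1
      refine ⟨1 + ζ ^ n, fun _ => ⟨?_, fun h => by rw [h]; simp⟩⟩
      have h4 : (RatFunc.X : RatFunc ℚ) ^ r * (RatFunc.X ^ (2 * d)) ^ k = RatFunc.X ^ n := by
        rw [← pow_mul, ← zpow_natCast, ← zpow_natCast, ← zpow_add₀ hX]
        congr 1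
        push_cast
        rw [← hr, ← h2]
        push_cast
        ring
      have h5 : (1 : RatFunc ℚ) - RatFunc.X ^ n ≠ 0 := by
        rw [sub_ne_zero, ← zpow_natCast]
        exact (RatFunc.X_zpow_ne_one (by exact_mod_cast hn.pos.ne')).symm
      rw [h4, show (1 - RatFunc.X ^ (2 * n)) / (1 - RatFunc.X ^ n) =
        (1 + RatFunc.X ^ n : RatFunc ℚ) by field_simp; ring]
      exact hasValueAt_one.add (hasValueAt_X.pow n)
    · refine ⟨_, fun _ => ⟨(hasValueAt_one.sub (hasValueAt_X.pow (2 * n))).div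
        (hasValueAt_one.sub ((hasValueAt_X.zpow hζ0 r).mul ((hasValueAt_X.pow (2 * d)).pow k)))
        (sub_ne_zero.2 (Ne.symm h1)), fun _ => ?_⟩⟩
      rw [pow2n, sub_self, zero_div]
  choose y hy using hy
  obtain ⟨G, g, hG, h1, h2⟩ := exists_left_sub_right_eq (ζ := ζ) (M := M) hM
    (hasValueAt_X.zpow hζ0 r) (hasValueAt_X.pow (2 * d)) (zpow_ne_zero r hζ0)
    (pow_ne_zero _ hζ0) (u := RatFunc.X ^ (2 * n)) (y := y)
    (fun i => by
      rw [← pow_mul, ← zpow_natCast]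
      exact RatFunc.X_zpow_ne_one (by exact_mod_cast (by positivity : 2 * d * (i + 1) ≠ 0)))
    (fun i => by
      have : ((RatFunc.X : RatFunc ℚ) ^ r) ^ 2 * (RatFunc.X ^ (2 * d)) ^ i =
          RatFunc.X ^ (2 * (r + d * i)) := by
        rw [← zpow_natCast, ← zpow_mul, ← pow_mul, ← zpow_natCast, ← zpow_add₀ hX]
        congr 1; push_cast; ring
      rw [this]
      exact RatFunc.X_zpow_ne_one (mul_ne_zero two_ne_zero (add_mul_ne_zero hd hnd hr hMn i)))
    (by
      rw [← zpow_natCast _ 2, ← zpow_mul, ← pow_mul, ← zpow_natCast, ← zpow_natCast,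
        ← zpow_add₀ hX]
      congr 1; push_cast; rw [← hr]; ring)
    (by
      rw [← pow2n, ← zpow_natCast _ 2, ← zpow_mul, ← pow_mul, ← zpow_natCast, ← zpow_natCast,
        ← zpow_add₀ hζ0]
      congr 1; push_cast; rw [← hr]; ring)
    (fun i hi h => by
      rw [← pow_mul, mul_assoc, pow_mul] at h
      have h3 := hnd.dvd_of_dvd_mul_left ((hζ.pow_eq_one_iff_dvd _).1 h)
      have := Nat.le_of_dvd (by omega) h3
      omega)
    (fun k hk => (hy k hk).1)
  refine ⟨G, g, hG, h1, fun h => h2 (fun k hk => (hy k hk).2 h) ?_⟩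
  have hc : 2 * (M + 1).choose 2 = M * (M + 1) := by
    rw [Nat.choose_two_right, Nat.mul_div_cancel' (by
      simpa [mul_comm] using (Nat.even_mul_succ_self M).two_dvd)]
    simp [mul_comm]
  -- The sign condition: the exponent of `ζ` is `dM(M+1) + r(M+1) = n(M+1)`.
  rw [← h, ← zpow_natCast (ζ ^ r), ← zpow_mul, ← pow_mul, ← pow_mul, ← zpow_natCast ζ,
    ← zpow_natCast ζ, ← zpow_add₀ hζ0]
  congr 1
  have hc' : (2 : ℤ) * ((M + 1).choose 2 : ℕ) = M * (M + 1) := by exact_mod_cast hc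
  push_cast
  linear_combination d * hc' + (M + 1) * hr

theorem cyclotomic_pow_dvd_num_seriesDifference (hn : Odd n) (hd : 0 < d)
    (hnd : Nat.Coprime n d) (hr : r + d * M = n) (hMn : M < n) (hM : 0 < M) :
    (cyclotomic n ℚ).comp (-X) ^ 3 * cyclotomic n ℚ ^ 2 ∣
      (seriesDifference (RatFunc.X ^ r) (RatFunc.X ^ (2 * d)) (RatFunc.X ^ (2 * n)) M).num := by
  have hζ := Complex.isPrimitiveRoot_exp n hn.pos.ne'
  set ζ := Complex.exp (2 * Real.pi * Complex.I / n)
  have hζ2 : IsPrimitiveRoot (ζ ^ 2) n := hζ.pow_of_coprime 2 (Nat.coprime_two_left.2 hn)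
  have hval : ∀ ε : ℂ, ε ^ 2 = ζ ^ 2 →
      HasValueAt ε (1 - RatFunc.X ^ (2 * n)) 0 := by
    intro ε hε
    have := (hasValueAt_one (ζ := ε)).sub (hasValueAt_X.pow (2 * n))
    rwa [pow_mul ε, hε, hζ2.pow_eq_one, sub_self] at this
  refine IsCoprime.mul_dvd ((isCoprime_cyclotomic_comp_neg hn).pow) ?_ ?_
  · obtain ⟨G, g, hG, h1, h2⟩ := exists_seriesDifference_eq (ζ := -ζ) hn hd hnd hr hMn hM
      (by rwa [neg_sq])
    rw [h2 (by rw [hn.neg_pow, hζ.pow_eq_one])] at hG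
    have hπ := cyclotomic_comp_neg_dvd_of_aeval hn.pos hζ
    -- The vanishing of the cofactor at `-ζ` supplies the third factor `Φ_n(-q)`; `(1 - u)²`
    -- supplies the other two.
    obtain ⟨G', z, hG', rfl⟩ := hG.exists_eq_mul hπ
    obtain ⟨v, z', hv, hv'⟩ := (hval (-ζ) (neg_sq ζ)).exists_eq_mul hπ
    refine HasValueAt.pow_dvd_num (irreducible_cyclotomic_comp_neg hn.pos)
      (aeval_cyclotomic_comp_neg_eq_zero hn.pos hζ) ((hv.pow 2).mul hG') ?_
    rw [h1, hv']
    ring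
  · obtain ⟨G, g, hG, h1, -⟩ := exists_seriesDifference_eq (ζ := ζ) hn hd hnd hr hMn hM hζ2
    obtain ⟨v, z', hv, hv'⟩ := (hval ζ rfl).exists_eq_mul (cyclotomic_dvd_of_aeval hn.pos hζ)
    refine HasValueAt.pow_dvd_num (cyclotomic.irreducible_rat hn.pos)
      (aeval_cyclotomic_eq_zero hn.pos hζ) ((hv.pow 2).mul hG) ?_
    rw [h1, hv']
    ring

end Cyclotomic

/-! ### Translation into the notation of the theorem. -/

theorem choose_two_zpow {K : Type*} [Field K] {q : K} (hq : q ≠ 0) (d k : ℕ) (r : ℤ) :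
    q ^ ((d : ℤ) * (k : ℤ) ^ 2 + k * (d - r)) =
      (q ^ (2 * d)) ^ ((k + 1).choose 2) * (q ^ r)⁻¹ ^ k := by
  have hc : 2 * (k + 1).choose 2 = k * (k + 1) := by
    rw [Nat.choose_two_right, Nat.mul_div_cancel' (by
      simpa [mul_comm] using (Nat.even_mul_succ_self k).two_dvd)]
    simp [mul_comm]
  have hc' : (2 : ℤ) * ((k + 1).choose 2 : ℕ) = k * (k + 1) := by exact_mod_cast hc
  rw [← zpow_neg, ← zpow_natCast (q ^ (-r)), ← zpow_mul, ← pow_mul, ← zpow_natCast q,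
    ← zpow_add₀ hq]
  congr 1
  push_cast
  linear_combination -d * hc'

theorem theorem4 (n d : ℕ) (r : ℤ) (hn : Odd n) (hd : 0 < d) (hnd : Nat.Coprime n d)
    (hr_lower : (n : ℤ) - d * n + d ≤ r) (hr_upper : r ≤ n) (hmod : (n : ℤ) ≡ r [ZMOD d])
    (M : ℕ) (hM : (M : ℤ) = ((n : ℤ) - r) / d) (q : RatFunc ℚ) (hq : q = RatFunc.X) :
    RatFuncModEq
      (((cyclotomic n ℚ).comp (-X)) ^ 3 * (cyclotomic n ℚ) ^ 2)
      (∑ k ∈ Finset.range (M + 1),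
        (-1) ^ k *
          (((1 + q ^ (2 * (d : ℤ) * k + r)) * qShifted (q ^ (2 * r)) (q ^ (2 * d)) k ^ 2) /
            ((1 + q ^ r) * qShifted (q ^ (2 * d)) (q ^ (2 * d)) k ^ 2)) *
          q ^ ((d : ℤ) * (k : ℤ) ^ 2 + k * (d - r)))
      ((-1) ^ M * (qInteger (q ^ 2) n / qInteger (q ^ 2) r) *
        q ^ ((((n : ℤ) - r) * (n + r - d)) / d) *
        ∑ k ∈ Finset.range (M + 1),
          (qShifted (q ^ (2 * r)) (q ^ (2 * d)) k * qShifted (q ^ r) (q ^ (2 * d)) k) /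
            (qShifted (q ^ (2 * d)) (q ^ (2 * d)) k *
              qShifted (q ^ (2 * (d : ℤ) + r)) (q ^ (2 * d)) k) *
          q ^ (2 * (k : ℤ) * (d - r))) := by
  have hdZ : (0 : ℤ) < d := by exact_mod_cast hd
  have hr : r + d * M = n := by
    have hdvd : (d : ℤ) ∣ n - r := by
      have := hmod.dvd
      rwa [← dvd_neg, neg_sub] at this
    rw [hM, Int.mul_ediv_cancel' hdvd]; ring
  -- The lower bound on `r` says exactly that `dM ≤ d(n-1)`.
  have hMn : M < n := by
    have h1 : (d : ℤ) * M ≤ d * (n - 1) := by linarith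
    have := le_of_mul_le_mul_left h1 hdZ
    omega
  have hX : q ≠ 0 := hq ▸ RatFunc.X_ne_zero
  have hq1 : ∀ m : ℤ, m ≠ 0 → q ^ m ≠ 1 := fun m hm => hq ▸ RatFunc.X_zpow_ne_one hm
  have hri := add_mul_ne_zero hd hnd hr hMn
  have hr0 : r ≠ 0 := by simpa using hri 0
  have hx2 : q ^ (2 * r) = (q ^ r) ^ 2 := by rw [mul_comm, zpow_mul]; norm_cast
  have hx1 : 1 + q ^ r ≠ 0 := by
    intro h
    apply hq1 (2 * r) (by omega)
    rw [hx2, eq_neg_of_add_eq_zero_right h]; norm_num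
  have hx1' : 1 - q ^ r ≠ 0 := sub_ne_zero.2 (hq1 r hr0).symm
  have hxk : ∀ k : ℕ, q ^ r * (q ^ (2 * d)) ^ k = q ^ (2 * (d : ℤ) * k + r) := by
    intro k
    rw [← pow_mul, ← zpow_natCast, ← zpow_add₀ hX]; congr 1; push_cast; ring
  have hxk1 : ∀ k : ℕ, 1 - q ^ r * (q ^ (2 * d)) ^ k ≠ 0 := by
    intro k
    rw [hxk, sub_ne_zero]
    refine (hq1 _ fun h => hri (2 * k) ?_).symm
    push_cast; linarith
  have hu : q ^ (2 * n) = (q ^ r) ^ 2 * (q ^ (2 * d)) ^ M := by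
    rw [← zpow_natCast _ 2, ← zpow_mul, ← pow_mul, ← zpow_natCast, ← zpow_natCast,
      ← zpow_add₀ hX]
    congr 1; push_cast; rw [← hr]; ring
  unfold RatFuncModEq
  have key : ∀ A B : RatFunc ℚ,
      A = ∑ k ∈ Finset.range (M + 1), leftCoeff (q ^ r) (q ^ (2 * d)) k *
        (qShifted ((q ^ r) ^ 2) (q ^ (2 * d)) k / qShifted (q ^ (2 * d)) (q ^ (2 * d)) k) ^ 2 →
      B = (1 - q ^ (2 * n)) * prefactor (q ^ r) (q ^ (2 * d)) M *
        ∑ k ∈ Finset.range (M + 1), rightCoeff (q ^ r) (q ^ (2 * d)) k *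
          qShifted ((q ^ r) ^ 2) (q ^ (2 * d)) k ^ 2 →
      (cyclotomic n ℚ).comp (-X) ^ 3 * cyclotomic n ℚ ^ 2 ∣ (A - B).num := by
    rintro A B rfl rfl
    -- For `M = 0` one has `r = n`, and `1 + x` vanishes at the roots of `Φ_n(-q)`, so the local
    -- argument fails; but both sides then equal `1`.
    rcases Nat.eq_zero_or_pos M with rfl | hM0
    · rw [hu]
      have : 1 - (q ^ r) ^ 2 ≠ 0 := by
        rw [show 1 - (q ^ r) ^ 2 = (1 + q ^ r) * (1 - q ^ r) by ring]
        exact mul_ne_zero hx1 hx1'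
      convert dvd_zero _
      convert RatFunc.num_zero
      simp only [zero_add, Finset.sum_range_one, leftCoeff, rightCoeff, prefactor, qShifted_zero,
        pow_zero, Nat.choose_zero_succ, Nat.choose_eq_zero_of_lt one_lt_two]
      field_simp
      ring
    · rw [hq]
      exact cyclotomic_pow_dvd_num_seriesDifference hn hd hnd hr hMn hM0
  apply key
  · refine Finset.sum_congr rfl fun k _ => ?_
    rw [choose_two_zpow hX, ← hxk, hx2, leftCoeff]
    simp only [div_eq_mul_inv, mul_inv, mul_pow, inv_pow]
    ring
  · have hquot : qInteger (q ^ 2) n / qInteger (q ^ 2) r =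
        (1 - q ^ (2 * n)) / (1 - (q ^ r) ^ 2) := by
      have h2 : 1 - q ^ 2 ≠ 0 := sub_ne_zero.2 (by
        have := hq1 2 two_ne_zero
        exact_mod_cast this.symm)
      rw [qInteger, qInteger, div_div_div_cancel_right₀ h2, zpow_natCast, ← pow_mul,
        ← zpow_natCast q 2, ← zpow_mul]
      push_cast
      rw [hx2]
    have hexp : q ^ ((((n : ℤ) - r) * (n + r - d)) / d) =
        ((q ^ r) ^ 2) ^ M * (q ^ (2 * d)) ^ (M.choose 2) := by
      have h1 : ((n : ℤ) - r) * (n + r - d) = d * (M * (n + r - d)) := by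
        linear_combination -(n + r - d : ℤ) * hr
      rw [h1, Int.mul_ediv_cancel_left _ hdZ.ne', ← zpow_natCast _ 2, ← zpow_mul,
        ← zpow_natCast _ M, ← zpow_mul, ← pow_mul, ← zpow_natCast q, ← zpow_add₀ hX]
      congr 1
      have hc' : (2 : ℤ) * (M.choose 2 : ℕ) = M * (M - 1) := by
        have h : ((2 * (M.choose 2 : ℕ) : ℤ) : ℚ) = ((M * (M - 1) : ℤ) : ℚ) := by
          push_cast
          rw [Nat.cast_choose_two]
          ring
        exact_mod_cast h
      push_cast
      linear_combination -d * hc' - (M : ℤ) * hr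
    rw [hquot, hexp, Finset.mul_sum, Finset.mul_sum]
    refine Finset.sum_congr rfl fun k _ => ?_
    have hshift : q ^ (2 * (d : ℤ) + r) = q ^ r * q ^ (2 * d) := by
      have := hxk 1
      rw [pow_one] at this
      rw [this]; push_cast; rw [mul_one]
    have hpow : q ^ (2 * (k : ℤ) * (d - r)) = (q ^ (2 * d) / (q ^ r) ^ 2) ^ k := by
      rw [← zpow_natCast q (2 * d), ← hx2, ← zpow_sub₀ hX, ← zpow_natCast _ k, ← zpow_mul]
      congr 1; push_cast; ring
    -- The shifted factorials in `q^r` telescope, leaving the denominator `1 - x Q^k` of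
    -- `rightCoeff`.
    have hratio : qShifted (q ^ r) (q ^ (2 * d)) k / qShifted (q ^ r * q ^ (2 * d)) (q ^ (2 * d)) k
        = (1 - q ^ r) / (1 - q ^ r * (q ^ (2 * d)) ^ k) := by
      have h0 : qShifted (q ^ r * q ^ (2 * d)) (q ^ (2 * d)) k ≠ 0 :=
        qShifted_ne_zero _ _ fun i _ => by
          rw [mul_assoc, ← pow_succ']
          exact (sub_ne_zero.1 (hxk1 (i + 1))).symm
      rw [div_eq_div_iff h0 (hxk1 k), ← qShifted_succ, qShifted_succ']
    have hq2 : qShifted ((q ^ r) ^ 2) (q ^ (2 * d)) k ≠ 0 := qShifted_ne_zero _ _ fun i _ => by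
      rw [← hx2, ← pow_mul, ← zpow_natCast, ← zpow_add₀ hX]
      refine hq1 _ fun h => hri i ?_
      push_cast at h
      linarith
    rw [hshift, hpow, hx2, mul_div_mul_comm, hratio, rightCoeff, prefactor,
      show 1 - (q ^ r) ^ 2 = (1 + q ^ r) * (1 - q ^ r) by ring]
    have hxk1k := hxk1 k
    field_simp
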